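/- Let $\varrho=\frac12\delta_{-1}+\frac12\delta_1$. For $n\ge 1$ and $\beta\in\mathbb R$ let $P_{n,\beta}$ be the Curie–Weiss measure on $\mathbb R^n$, $$dP_{n,\beta}(x)=\frac1{Z_{n,\beta}}\exp\Bigl(\frac{\beta}{2n}S_n^2\Bigr)\,d\varrho^{\otimes n}(x),\qquad S_n=x_1+\dots+x_n,$$ with $Z_{n,\beta}$ the normalizing constant. For $\gamma\in\mathbb R$ let $$F_\gamma(z)=\frac1{Z_\gamma}\int_{-\infty}^z \exp\Bigl(-\frac{x^4}{12}+\frac{\gamma x^2}{2}\Bigr)dx,\qquad Z_\gamma=\int_{\mathbb R}\exp\Bigl(-\frac{x^4}{12}+\frac{\gamma x^2}{2}\Bigr)dx,$$ $F=F_0$, and let $\Phi$ be the distribution function of the standard normal law $N(0,1)$. Let $(\beta_n)_{n\ge1}$ be a monotone (nondecreasing or nonincreasing) sequence of real numbers with $\beta_n\to1$ (so $\beta_n>0$ for all large $n$). 1. Suppose $\beta_n-1=\gamma/\sqrt n$ for all $n\ge1$, with some $\gamma\neq0$. Then for all $n\ge1$ $$\sup_{z\in\mathbb R}\bigl|P_{n,\beta_n}(S_n/n^{3/4}\le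 z)-F_\gamma(z)\bigr|\le C\,n^{-1/2},$$ where $C$ depends only on $\gamma$. 2. Suppose $|\beta_n-1|\ll n^{-1/2}$, i.e. $\sqrt n\,|\beta_n-1|\to0$. Then $S_n/n^{3/4}$ under $P_{n,\beta_n}$ converges in distribution to the law with distribution function $F$. If moreover $|\beta_n-1|\le K/n$ for all $n\ge1$ with some constant $K$, then for all $n\ge1$ $$\sup_{z\in\mathbb R}\bigl|P_{n,\beta_n}(S_n/n^{3/4}\le z)-F(z)\bigr|\le C\,n^{-1/2},$$ where $C$ depends only on $K$. 3. Suppose $\beta_n<1$ for all $n\ge1$ and $|\beta_n-1|\gg n^{-1/2}$, i.e. $\sqrt n\,(1-\beta_n)\to\infty$. Then $$\sup_{z\in\mathbb R}\Bigl|P_{n,\beta_n}\Bigl(\sqrt{\tfrac{1-\beta_n}{n}}\;S_n\le z\Bigr)-\Phi(z)\Bigr|\to0 .$$ If moreover $|\beta_n-1|\gg n^{-1/4}$, i.e. $n^{1/4}(1-\beta_n)\to\infty$, then this supremum is at most $C\,n^{-1/2}$ for all sufficiently large $n$, where $C$ is an absolute constant; consequently it is at most $C'n^{-1/2}$ for all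 $n\ge1$, with $C'$ depending only on the sequence $(\beta_n)$. -/

import Mathlib

open Filter Topology MeasureTheory ProbabilityTheory Asymptotics

noncomputable section

/-- The symmetric Bernoulli single-spin law `ϱ = ½ δ₋₁ + ½ δ₁` on `ℝ`. -/
def spinLaw : Measure ℝ :=
  (2⁻¹ : ENNReal) • Measure.dirac (-1) + (2⁻¹ : ENNReal) • Measure.dirac 1

instance spinLaw_isProbabilityMeasure : IsProbabilityMeasure spinLaw := by
  constructor
  simp [spinLaw, ENNReal.inv_two_add_inv_two]

/-- The total magnetization `Sₙ = X₁ + ⋯ + Xₙ`. -/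
def magnetization (n : ℕ) (x : Fin n → ℝ) : ℝ := ∑ i, x i

/-- The classical Curie–Weiss measure `P_{n,β}` on `ℝⁿ`: it has density
`Z⁻¹ exp (β Sₙ² / (2 n))` with respect to the product measure `ϱ^{⊗ n}`
(`Measure.tilted` multiplies by `exp` of the given function and normalizes). -/
def curieWeiss (n : ℕ) (β : ℝ) : Measure (Fin n → ℝ) :=
  (Measure.pi fun _ : Fin n => spinLaw).tilted
    fun x => β / (2 * n) * magnetization n x ^ 2

/-- The probability law on `ℝ` with Lebesgue density proportional to
`exp (-x⁴/12 + γ x²/2)`; its distribution function is `F_γ`, and `F` for `γ = 0`. -/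
def quarticLaw (γ : ℝ) : Measure ℝ :=
  (volume : Measure ℝ).tilted fun x => -x ^ 4 / 12 + γ * x ^ 2 / 2

/-- The Kolmogorov distance `sup_z |μ (-∞, z] - ν (-∞, z]|` of two laws on `ℝ`. -/
def kolmogorovDist (μ ν : Measure ℝ) : ℝ :=
  ⨆ z : ℝ, |μ.real (Set.Iic z) - ν.real (Set.Iic z)|

/-- The critically normalized magnetization `Sₙ / n^{3/4}`. -/
def criticalSum (n : ℕ) (x : Fin n → ℝ) : ℝ := magnetization n x / (n : ℝ) ^ (3 / 4 : ℝ)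

/-- The normalized magnetization `√((1 - β) / n) Sₙ`, used for `β < 1`. -/
def gaussianSum (n : ℕ) (β : ℝ) (x : Fin n → ℝ) : ℝ :=
  Real.sqrt ((1 - β) / n) * magnetization n x

/-- `β₁, β₂, …` is monotone (in either direction) and converges to `1`.
The value at index `0` is irrelevant. Positivity of `βₙ` for large `n` is automatic. -/
def MonotoneToOne (β : ℕ → ℝ) : Prop :=
  (MonotoneOn β (Set.Ici 1) ∨ AntitoneOn β (Set.Ici 1)) ∧ Tendsto β atTop (𝓝 1)

theorem integrable_exp_curieWeiss (n : ℕ) (β : ℝ) :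
    Integrable (fun x : Fin n → ℝ => Real.exp (β / (2 * n) * magnetization n x ^ 2))
      (Measure.pi fun _ : Fin n => spinLaw) := by
  have h1 : ∀ᵐ y ∂spinLaw, |y| ≤ 1 := by
    simp [spinLaw, ae_add_measure_iff, ae_dirac_eq]
  have h2 : ∀ᵐ x ∂(Measure.pi fun _ : Fin n => spinLaw), ∀ i, |x i| ≤ 1 := by
    rw [ae_all_iff]
    intro i
    exact (Measure.tendsto_eval_ae_ae (μ := fun _ : Fin n => spinLaw) (i := i)).eventually h1
  refine Integrable.of_bound (C := Real.exp (|β / (2 * n)| * (n : ℝ) ^ 2)) ?_ ?_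
  · unfold magnetization
    fun_prop
  · filter_upwards [h2] with x hx
    rw [Real.norm_eq_abs, Real.abs_exp, Real.exp_le_exp]
    have hS : |magnetization n x| ≤ n := by
      calc |magnetization n x| ≤ ∑ i : Fin n, |x i| := Finset.abs_sum_le_sum_abs _ _
        _ ≤ ∑ _i : Fin n, (1 : ℝ) := Finset.sum_le_sum fun i _ => hx i
        _ = n := by simp
    have hS2 : magnetization n x ^ 2 ≤ (n : ℝ) ^ 2 := by
      rw [← sq_abs]
      gcongr
    calc β / (2 * n) * magnetization n x ^ 2 ≤ |β / (2 * n)| * magnetization n x ^ 2 := by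
          gcongr
          exact le_abs_self _
      _ ≤ _ := by gcongr

instance curieWeiss_isProbabilityMeasure (n : ℕ) (β : ℝ) :
    IsProbabilityMeasure (curieWeiss n β) :=
  isProbabilityMeasure_tilted (integrable_exp_curieWeiss n β)

theorem integrable_exp_quartic (γ : ℝ) :
    Integrable (fun x : ℝ => Real.exp (-x ^ 4 / 12 + γ * x ^ 2 / 2)) := by
  have h := (integrable_exp_neg_mul_sq (b := 1) one_pos).const_mul
    (Real.exp (3 * (γ / 2 + 1) ^ 2))
  refine h.mono' (by fun_prop) (ae_of_all _ fun x => ?_)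
  rw [Real.norm_eq_abs, Real.abs_exp, ← Real.exp_add, Real.exp_le_exp]
  nlinarith [sq_nonneg (x ^ 2 - 6 * (γ / 2 + 1))]

instance quarticLaw_isProbabilityMeasure (γ : ℝ) : IsProbabilityMeasure (quarticLaw γ) :=
  isProbabilityMeasure_tilted (integrable_exp_quartic γ)

end

/-! Under the Curie–Weiss measure `Sₙ` takes the value `2j - n` with probability proportional to the
explicit weight `curieWeissWeight n β j`, so a local limit estimate for these weights suffices. The
ratio of consecutive weights is elementary: with `u = 2j + 1 - n` and `v = u / n`, the logarithm of
the weight grows by about `2(β - 1)v - (2/3)v³`. On the scale `y = n^{-3/4} Sₙ` the two terms are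
increments of `√n (β - 1) y²/2` and `-y⁴/12`, which gives the quartic laws when `√n (β - 1)` stays
bounded. When `√n (1 - β) → ∞` the linear term dominates; on the scale `√((1 - β)/n) Sₙ` it gives
`-y²/2`, and the cubic term costs an error of order `1 / ((1 - β)² n)`.

`kolmogorovDist_map_magnetization_le` turns increment bounds into a Kolmogorov bound for any limit
density proportional to `exp ∘ g`. Summing increments from the centre compares the logarithm of each
weight with `g`. A two-sided bound is needed only for `|Sₙ| ≤ n/2`; further out a one-sided bound
and the decay of `exp ∘ g` are enough. The weights, spread over cells of width `2s`, are then within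
`O(τ) / (1 + y²)` of the density, where `τ = η + 1/(s n)² + s`, and integration gives the rate.
Normalizing constants are compared in the same way, so Stirling's formula is not needed.

The inputs are `quartic_increment_bounds` and `gaussian_increment_bounds`. The resulting bounds are
uniform in `β`, and each regime of the theorem is a substitution into one of them. -/

/-! ### Lattice sums, integrals and telescoping -/

theorem abs_exp_sub_one_le_abs_mul_exp {E F : ℝ} (h : E ≤ F) (hF : 0 ≤ F) :
    |Real.exp E - 1| ≤ |E| * Real.exp F := by
  rcases le_total 0 E with hE | hE
  · rw [abs_of_nonneg (by linarith [Real.add_one_le_exp E]), abs_of_nonneg hE]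
    have h1 : (1 - E) * Real.exp E ≤ 1 := by
      calc (1 - E) * Real.exp E ≤ Real.exp (-E) * Real.exp E := by
            gcongr; linarith [Real.add_one_le_exp (-E)]
        _ = 1 := by rw [← Real.exp_add]; simp
    have h2 : E * Real.exp E ≤ E * Real.exp F := by gcongr
    linarith
  · rw [abs_of_nonpos (by linarith [Real.exp_le_one_iff.2 hE]), abs_of_nonpos hE]
    have h1 : 1 ≤ Real.exp F := Real.one_le_exp hF
    nlinarith [Real.add_one_le_exp E]

/-- Comparison of a weighted sum over the lattice `s (2 j - n)`, `0 ≤ j ≤ n`, with an integral: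
the weights are smeared over adjacent cells of width `2 s`. -/
theorem abs_sum_lattice_sub_setIntegral_le {n : ℕ} {s δ M : ℝ} (hs : 0 < s) (hδ : 0 ≤ δ)
    {c : ℕ → ℝ} {p : ℝ → ℝ} (hp : Integrable p) (hp0 : ∀ y, 0 ≤ p y) (hM : ∀ y, p y ≤ M)
    (hin : ∀ j ≤ n, ∀ y, |y - s * (2 * j - n)| ≤ s → |c j - p y| ≤ δ / (1 + y ^ 2))
    (hout : ∀ y, s * n ≤ |y| → p y ≤ δ / (1 + y ^ 2))
    {B : Set ℝ} (hB : MeasurableSet B) (z : ℝ)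
    (hBz : ∀ x y, |y - x| ≤ s → (x ∈ B ↔ y ∈ B) ∨ |y - z| ≤ s) :
    |∑ j ∈ Finset.range (n + 1), B.indicator (fun _ => 2 * s * c j) (s * (2 * j - n))
      - ∫ y in B, p y| ≤ Real.pi * δ + 2 * s * M := by
  classical
  have hM0 : 0 ≤ M := (hp0 0).trans (hM 0)
  set cell : ℕ → Set ℝ := fun j => Set.Ioc (s * (2 * j - n - 1)) (s * (2 * j - n + 1)) with hcell
  set a : ℕ → ℝ := fun j => B.indicator (fun _ => c j) (s * (2 * j - n)) with ha
  set G : ℝ → ℝ := fun y => ∑ j ∈ Finset.range (n + 1), (cell j).indicator (fun _ => a j) y with hG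
  have hint : ∀ j ∈ Finset.range (n + 1),
      Integrable (fun y => (cell j).indicator (fun _ => a j) y) := fun j _ =>
    (integrable_indicator_iff measurableSet_Ioc).2 (integrableOn_const (by simp))
  have hGint : Integrable G := integrable_finsetSum _ hint
  have hGval : ∫ y, G y =
      ∑ j ∈ Finset.range (n + 1), B.indicator (fun _ => 2 * s * c j) (s * (2 * j - n)) := by
    rw [hG, integral_finsetSum _ hint]
    refine Finset.sum_congr rfl fun j _ => ?_
    rw [integral_indicator measurableSet_Ioc, setIntegral_const, measureReal_def, Real.volume_Ioc,
      ENNReal.toReal_ofReal (by nlinarith)]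
    simp only [ha, Set.indicator_apply, smul_eq_mul]
    split_ifs <;> ring
  rw [← hGval, ← integral_indicator hB, ← integral_sub hGint (hp.indicator hB), ← Real.norm_eq_abs]
  -- The integrand is dominated by `δ / (1 + y²)`, of integral `πδ`, plus `M` on the window of width
  -- `2s` about `z`, where a cell may straddle the boundary of `B`.
  have hb1 : Integrable (fun y : ℝ => δ * (1 + y ^ 2)⁻¹) := integrable_inv_one_add_sq.const_mul δ
  have hb2 : Integrable ((Set.Icc (z - s) (z + s)).indicator fun _ => M) :=
    (integrable_indicator_iff measurableSet_Icc).2 (integrableOn_const (by simp))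
  have hbd : ∫ y, (δ * (1 + y ^ 2)⁻¹ + (Set.Icc (z - s) (z + s)).indicator (fun _ => M) y) =
      Real.pi * δ + 2 * s * M := by
    rw [integral_add hb1 hb2, integral_const_mul, integral_univ_inv_one_add_sq,
      integral_indicator measurableSet_Icc, setIntegral_const, measureReal_def, Real.volume_Icc,
      ENNReal.toReal_ofReal (by linarith), smul_eq_mul]
    ring
  rw [← hbd]
  refine norm_integral_le_of_norm_le (hb1.add hb2) (ae_of_all _ fun y => ?_)
  rw [Real.norm_eq_abs, ← div_eq_mul_inv]
  have hind0 : 0 ≤ (Set.Icc (z - s) (z + s)).indicator (fun _ => M) y :=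
    Set.indicator_nonneg (fun _ _ => hM0) _
  have hδy : 0 ≤ δ / (1 + y ^ 2) := by positivity
  by_cases hy : ∃ i ≤ n, y ∈ cell i
  · obtain ⟨i, hi, hyi⟩ := hy
    have hGy : G y = a i := by
      simp only [hG]
      rw [Finset.sum_eq_single i, Set.indicator_of_mem hyi]
      · intro j _ hji
        refine Set.indicator_of_notMem (fun hyj => hji ?_) _
        simp only [hcell, Set.mem_Ioc] at hyi hyj
        have h1 : (2 * j - n - 1 : ℝ) < 2 * i - n + 1 := lt_of_mul_lt_mul_left
          (hyj.1.trans_le hyi.2) hs.le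
        have h2 : (2 * i - n - 1 : ℝ) < 2 * j - n + 1 := lt_of_mul_lt_mul_left
          (hyi.1.trans_le hyj.2) hs.le
        have h1' : (j : ℝ) < i + 1 := by linarith
        have h2' : (i : ℝ) < j + 1 := by linarith
        norm_cast at h1' h2'
        omega
      · intro h
        exact absurd (Finset.mem_range.2 (by omega)) h
    have hdist : |y - s * (2 * i - n)| ≤ s := by
      simp only [hcell, Set.mem_Ioc] at hyi
      rw [abs_le]; constructor <;> nlinarith [hyi.1, hyi.2]
    have hci := hin i hi y hdist
    rw [hGy]
    simp only [ha]
    rcases hBz _ _ hdist with hiff | hz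
    · by_cases hyB : y ∈ B
      · rw [Set.indicator_of_mem (hiff.2 hyB), Set.indicator_of_mem hyB]
        linarith
      · rw [Set.indicator_of_notMem (fun h => hyB (hiff.1 h)), Set.indicator_of_notMem hyB]
        simp only [sub_zero, abs_zero]
        linarith
    · have hmem : y ∈ Set.Icc (z - s) (z + s) := by
        rw [abs_le] at hz; constructor <;> linarith
      rw [Set.indicator_of_mem hmem]
      have h0 := hp0 y
      have h1 := hM y
      rw [abs_le] at hci ⊢
      simp only [Set.indicator_apply]
      split_ifs <;> constructor <;> linarith
  · have hGy : G y = 0 := by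
      simp only [hG]
      refine Finset.sum_eq_zero fun j hj => Set.indicator_of_notMem (fun h => hy ⟨j, ?_, h⟩) _
      have := Finset.mem_range.1 hj
      omega
    have hlarge : s * n ≤ |y| := by
      by_contra hlt
      rw [not_le, abs_lt] at hlt
      -- Solving `y ≤ s (2j - n + 1)` for the least `j` gives this index.
      refine hy ⟨⌈(y / s + n - 1) / 2⌉₊, ?_, ?_⟩
      · rw [Nat.ceil_le]
        have : y / s < n := by rw [div_lt_iff₀ hs]; linarith
        linarith
      · set v := (y / s + n - 1) / 2 with hv
        have hyv : y = s * (2 * v - n + 1) := by rw [hv]; field_simp; ring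
        have h1 : v ≤ ⌈v⌉₊ := Nat.le_ceil v
        have h2 : (⌈v⌉₊ : ℝ) < v + 1 := by
          rcases le_or_gt 0 v with h | h
          · exact Nat.ceil_lt_add_one h
          -- Here the natural ceiling truncates to `0`; this is harmless since `-s n < y` forces `v
          -- > -1/2`.
          · rw [Nat.ceil_eq_zero.2 h.le]
            have : -(n : ℝ) < 2 * v - n + 1 := by
              refine lt_of_mul_lt_mul_left (a := s) ?_ hs.le
              rw [← hyv]; linarith [hlt.1]
            push_cast
            linarith
        simp only [hcell, Set.mem_Ioc]
        rw [hyv]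
        constructor
        · exact mul_lt_mul_of_pos_left (by linarith) hs
        · exact mul_le_mul_of_nonneg_left (by linarith) hs.le
    have h0 := hp0 y
    have h1 := hout y hlarge
    rw [hGy, zero_sub, abs_neg]
    simp only [Set.indicator_apply B]
    split_ifs
    · rw [abs_of_nonneg h0]; linarith
    · rw [abs_zero]; linarith

/-- Telescoping of increment bounds from the centre of the lattice `s (2 j - n)`. -/
theorem telescoped_bounds {n : ℕ} {s B η : ℝ} (hs : 0 < s) (hB : 0 ≤ B) (hη : 0 ≤ η) {E : ℕ → ℝ}
    (h0 : E ((n + 1) / 2) = 0)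
    (hup : ∀ j < n, n < 2 * j + 1 → E (j + 1) - E j ≤ B * s * (s * (2 * j + 1 - n)))
    (habs : ∀ j < n, n < 2 * j + 1 → (2 * j + 1 - n : ℝ) ≤ (n + 1) / 2 →
      |E (j + 1) - E j| ≤ η * s * (s * (2 * j + 1 - n) + (s * (2 * j + 1 - n)) ^ 5))
    (j : ℕ) (hj : (n + 1) / 2 ≤ j) : j ≤ n →
    E j ≤ B / 4 * (s * (2 * j - n)) ^ 2 ∧
    ((2 * j - n : ℝ) ≤ n / 2 →
      |E j| ≤ η / 4 * ((s * (2 * j - n)) ^ 2 + (s * (2 * j - n)) ^ 6)) := by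
  induction j, hj using Nat.le_induction with
  | base =>
    intro _
    rw [h0]
    refine ⟨by positivity, fun _ => ?_⟩
    rw [abs_zero]
    positivity
  | succ j hj ih =>
    intro hjn
    have hlt : n < 2 * j + 1 ∨ n = 2 * j + 1 := by omega
    obtain hlt | heq := hlt
    · obtain ⟨ih1, ih2⟩ := ih (by omega)
      have hm : (0 : ℝ) < 2 * j + 1 - n := by
        have : (n : ℝ) < 2 * j + 1 := by exact_mod_cast hlt
        linarith
      have hu := hup j (by omega) hlt
      have ha := habs j (by omega) hlt
      push_cast
      set u : ℝ := 2 * j + 1 - n with hu'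
      have e1 : (2 * j - n : ℝ) = u - 1 := by rw [hu']; ring
      have e2 : (2 * (j + 1) - n : ℝ) = u + 1 := by rw [hu']; ring
      rw [e1] at ih1 ih2
      rw [e2]
      refine ⟨?_, fun hle => ?_⟩
      · nlinarith
      · have h1 := ih2 (by linarith)
        have h2 := ha (by linarith)
        have h3 : |E (j + 1)| ≤ |E j| + |E (j + 1) - E j| := by
          have := abs_add_le (E j) (E (j + 1) - E j)
          rwa [add_sub_cancel] at this
        -- The second and sixth powers grow by at least `4s` times the first and fifth powers of `s
        -- u`, whence the factors `B / 4` and `η / 4`.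
        have h4 : (s * (u + 1)) ^ 2 - (s * (u - 1)) ^ 2 = 4 * s * (s * u) := by ring
        have h5 : 4 * s * (s * u) ^ 5 ≤ (s * (u + 1)) ^ 6 - (s * (u - 1)) ^ 6 := by
          have : (s * (u + 1)) ^ 6 - (s * (u - 1)) ^ 6 - 4 * s * (s * u) ^ 5
              = s ^ 6 * (8 * u ^ 5 + 40 * u ^ 3 + 12 * u) := by ring
          have h : 0 ≤ s ^ 6 * (8 * u ^ 5 + 40 * u ^ 3 + 12 * u) := by positivity
          linarith
        have h6 := mul_le_mul_of_nonneg_left h5 hη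
        nlinarith
    · exfalso
      omega

/-! ### The law of the magnetization and its weights -/

theorem measurable_magnetization (n : ℕ) : Measurable (magnetization n) := by
  unfold magnetization
  fun_prop

theorem lintegral_spinLaw (f : ℝ → ENNReal) :
    ∫⁻ y, f y ∂spinLaw = 2⁻¹ * f (-1) + 2⁻¹ * f 1 := by
  rw [spinLaw, lintegral_add_measure, lintegral_smul_measure, lintegral_smul_measure,
    lintegral_dirac, lintegral_dirac, smul_eq_mul, smul_eq_mul]

/-- Splitting off the first spin shifts the sum by `±1`; Pascal's rule recombines the two halves. -/
theorem lintegral_magnetization (n : ℕ) {f : ℝ → ENNReal} (hf : Measurable f) :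
    ∫⁻ x, f (magnetization n x) ∂(Measure.pi fun _ : Fin n => spinLaw) =
      ∑ j ∈ Finset.range (n + 1), (n.choose j : ENNReal) * (2⁻¹ ^ n * f (2 * j - n)) := by
  induction n generalizing f with
  | zero => simp [magnetization]
  | succ n ih =>
    have hmp := measurePreserving_piFinSuccAbove (fun _ : Fin (n + 1) => spinLaw) 0
    have hmeas : Measurable fun q : ℝ × (Fin n → ℝ) => f (q.1 + magnetization n q.2) :=
      hf.comp (measurable_fst.add ((measurable_magnetization n).comp measurable_snd))
    have h1 : ∀ x : Fin (n + 1) → ℝ, f (magnetization (n + 1) x) =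
        (fun q : ℝ × (Fin n → ℝ) => f (q.1 + magnetization n q.2))
          (MeasurableEquiv.piFinSuccAbove (fun _ => ℝ) 0 x) := fun x => by
      simp [magnetization, Fin.sum_univ_succ, MeasurableEquiv.piFinSuccAbove, Fin.tail]
    simp_rw [h1]
    rw [hmp.lintegral_comp hmeas, lintegral_prod _ hmeas.aemeasurable, lintegral_spinLaw,
      ih (f := fun y => f (-1 + y)) (by fun_prop), ih (f := fun y => f (1 + y)) (by fun_prop),
      Finset.sum_choose_succ_mul (fun i _ => 2⁻¹ ^ (n + 1) * f (2 * i - (n + 1 : ℕ))) n,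
      Finset.mul_sum, Finset.mul_sum]
    refine congrArg₂ (· + ·) (Finset.sum_congr rfl fun j _ => ?_)
      (Finset.sum_congr rfl fun j _ => ?_)
    · have : (-1 + (2 * j - n) : ℝ) = 2 * j - (n + 1 : ℕ) := by push_cast; ring
      rw [this]; ring
    · have : (1 + (2 * j - n) : ℝ) = 2 * (j + 1 : ℕ) - (n + 1 : ℕ) := by push_cast; ring
      rw [this]; ring

theorem map_magnetization (n : ℕ) :
    (Measure.pi fun _ : Fin n => spinLaw).map (magnetization n) =
      ∑ j ∈ Finset.range (n + 1),
        ((n.choose j : ENNReal) * 2⁻¹ ^ n) • Measure.dirac (2 * j - n : ℝ) := by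
  ext A hA
  rw [← lintegral_indicator_one hA,
    lintegral_map (measurable_one.indicator hA) (measurable_magnetization n),
    lintegral_magnetization n (measurable_one.indicator hA), Measure.finsetSum_apply]
  refine Finset.sum_congr rfl fun j _ => ?_
  rw [Measure.smul_apply, Measure.dirac_apply' _ hA, smul_eq_mul, mul_assoc]

theorem integral_magnetization (n : ℕ) {f : ℝ → ℝ} (hf : Measurable f) :
    ∫ x, f (magnetization n x) ∂(Measure.pi fun _ : Fin n => spinLaw) =
      (2⁻¹ : ℝ) ^ n * ∑ j ∈ Finset.range (n + 1), (n.choose j : ℝ) * f (2 * j - n) := by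
  rw [← integral_map (measurable_magnetization n).aemeasurable hf.aestronglyMeasurable,
    map_magnetization, integral_finsetSum_measure, Finset.mul_sum]
  · refine Finset.sum_congr rfl fun j _ => ?_
    rw [integral_smul_measure, integral_dirac]
    simp
    ring
  · intro j _
    refine Integrable.smul_measure (integrable_dirac ?_) ?_
    · exact enorm_lt_top
    · exact ENNReal.mul_ne_top (by simp) (by simp)

noncomputable section

/-- The unnormalized Curie–Weiss weight of the event `Sₙ = 2 j - n`. -/
def curieWeissWeight (n : ℕ) (β : ℝ) (j : ℕ) : ℝ :=
  n.choose j * Real.exp (β / (2 * n) * (2 * j - n) ^ 2)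

end

theorem curieWeissWeight_pos {n : ℕ} (β : ℝ) {j : ℕ} (hj : j ≤ n) :
    0 < curieWeissWeight n β j := by
  have : 0 < n.choose j := Nat.choose_pos hj
  unfold curieWeissWeight
  positivity

theorem curieWeissWeight_nonneg (n : ℕ) (β : ℝ) (j : ℕ) : 0 ≤ curieWeissWeight n β j := by
  unfold curieWeissWeight
  positivity

theorem curieWeissWeight_symm {n : ℕ} (β : ℝ) {j : ℕ} (hj : j ≤ n) :
    curieWeissWeight n β (n - j) = curieWeissWeight n β j := by
  rw [curieWeissWeight, curieWeissWeight, Nat.choose_symm hj, Nat.cast_sub hj]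
  congr 3
  ring

theorem sum_curieWeissWeight_pos (n : ℕ) (β : ℝ) :
    0 < ∑ j ∈ Finset.range (n + 1), curieWeissWeight n β j :=
  Finset.sum_pos (fun j hj => curieWeissWeight_pos β (Nat.lt_succ_iff.1 (Finset.mem_range.1 hj)))
    ⟨0, by simp⟩

theorem curieWeiss_map_real (n : ℕ) (β s : ℝ) {B : Set ℝ} (hB : MeasurableSet B) :
    ((curieWeiss n β).map fun x => s * magnetization n x).real B =
      (∑ j ∈ Finset.range (n + 1),
        B.indicator (fun _ => curieWeissWeight n β j) (s * (2 * j - n))) /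
        ∑ j ∈ Finset.range (n + 1), curieWeissWeight n β j := by
  classical
  have hm : Measurable fun x => s * magnetization n x := (measurable_magnetization n).const_mul s
  have hZ : ∫ x, Real.exp (β / (2 * n) * magnetization n x ^ 2)
      ∂(Measure.pi fun _ : Fin n => spinLaw) =
      (2⁻¹ : ℝ) ^ n * ∑ j ∈ Finset.range (n + 1), curieWeissWeight n β j :=
    integral_magnetization n (f := fun y => Real.exp (β / (2 * n) * y ^ 2)) (by fun_prop)
  rw [map_measureReal_apply hm hB, curieWeiss, measureReal_def,
    tilted_apply_eq_ofReal_integral' _ (hm hB), ENNReal.toReal_ofReal (by positivity),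
    ← integral_indicator (hm hB), hZ]
  set W := ∑ j ∈ Finset.range (n + 1), curieWeissWeight n β j
  have hmB : MeasurableSet ((fun y : ℝ => s * y) ⁻¹' B) := (measurable_const_mul s) hB
  refine (integral_magnetization n (f := ((fun y : ℝ => s * y) ⁻¹' B).indicator fun y =>
    Real.exp (β / (2 * n) * y ^ 2) / ((2⁻¹ : ℝ) ^ n * W))
    (Measurable.indicator (by fun_prop) hmB)).trans ?_
  rw [Finset.mul_sum, Finset.sum_div]
  refine Finset.sum_congr rfl fun j _ => ?_
  simp only [Set.indicator_apply, Set.mem_preimage, curieWeissWeight]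
  split_ifs
  · field_simp
  · simp

/-- The binomial ratio `(n - j) / (j + 1)` equals `(1 - t) / (1 + t)` for `t = (2j + 1 - n) / (n +
1)`, which makes the increment accessible to the odd power series of `log ((1 + t) / (1 - t))`. -/
theorem log_curieWeissWeight_succ_sub {n j : ℕ} (β : ℝ) (hj : j < n) :
    Real.log (curieWeissWeight n β (j + 1)) - Real.log (curieWeissWeight n β j) =
      -Real.log ((1 + (2 * j + 1 - n : ℝ) / (n + 1)) / (1 - (2 * j + 1 - n : ℝ) / (n + 1))) +
        2 * β * (2 * j + 1 - n) / n := by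
  have hc0 : (n.choose j : ℝ) ≠ 0 := by exact_mod_cast (Nat.choose_pos hj.le).ne'
  have hc1 : (n.choose (j + 1) : ℝ) ≠ 0 := by exact_mod_cast (Nat.choose_pos hj).ne'
  have hn : (n : ℝ) ≠ 0 := by norm_cast; omega
  have hjn : (0 : ℝ) < n - j := by
    have : (j : ℝ) < n := by exact_mod_cast hj
    linarith
  have hj1 : (0 : ℝ) < j + 1 := by positivity
  have hn1 : (0 : ℝ) < n + 1 := by positivity
  have hch : (n.choose (j + 1) : ℝ) * (j + 1) = n.choose j * (n - j) := by
    rw [← Nat.cast_sub hj.le]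
    exact_mod_cast Nat.choose_succ_right_eq n j
  have hratio : (1 + (2 * j + 1 - n : ℝ) / (n + 1)) / (1 - (2 * j + 1 - n : ℝ) / (n + 1)) =
      (j + 1) / (n - j) := by
    have h1 : 1 + (2 * j + 1 - n : ℝ) / (n + 1) = 2 * (j + 1) / (n + 1) := by field_simp; ring
    have h2 : 1 - (2 * j + 1 - n : ℝ) / (n + 1) = 2 * (n - j) / (n + 1) := by field_simp; ring
    rw [h1, h2]
    field_simp
  have hlog := congrArg Real.log hch
  rw [Real.log_mul hc1 hj1.ne', Real.log_mul hc0 hjn.ne'] at hlog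
  rw [hratio, Real.log_div hj1.ne' hjn.ne', curieWeissWeight, curieWeissWeight,
    Real.log_mul hc1 (Real.exp_ne_zero _), Real.log_mul hc0 (Real.exp_ne_zero _), Real.log_exp,
    Real.log_exp]
  have : β / (2 * n) * (2 * (j + 1 : ℕ) - n : ℝ) ^ 2 - β / (2 * n) * (2 * j - n : ℝ) ^ 2 =
      2 * β * (2 * j + 1 - n) / n := by
    push_cast
    field_simp
    ring
  linarith

/-! ### From increment bounds to Kolmogorov distance -/

/-- Since `A' / Z' ≤ 1`, no lower bound on the approximating normalizer `Z'` is required. -/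
theorem abs_div_sub_div_le {A A' Z Z' R : ℝ} (hZ : 0 < Z) (hZ' : 0 < Z') (hA' : 0 ≤ A')
    (hAZ' : A' ≤ Z') (h1 : |A' - A| ≤ R) (h2 : |Z' - Z| ≤ R) :
    |A' / Z' - A / Z| ≤ 2 * R / Z := by
  have hq0 : 0 ≤ A' / Z' := by positivity
  have hq1 : A' / Z' ≤ 1 := (div_le_one hZ').2 hAZ'
  have he : A' / Z' - A / Z = ((A' - A) - A' / Z' * (Z' - Z)) / Z := by
    field_simp
    ring
  rw [he, abs_div, abs_of_pos hZ]
  gcongr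
  calc |(A' - A) - A' / Z' * (Z' - Z)| ≤ |A' - A| + |A' / Z' * (Z' - Z)| := abs_sub _ _
    _ ≤ R + 1 * R := by
        rw [abs_mul, abs_of_nonneg hq0]
        gcongr
    _ = 2 * R := by ring

theorem one_add_sq_le_three_mul {x y s : ℝ} (hs : s ≤ 1) (h : |y - x| ≤ s) :
    1 + y ^ 2 ≤ 3 * (1 + x ^ 2) := by
  have h1 : |y - x| ≤ 1 := h.trans hs
  have h2 : (y - x) ^ 2 ≤ 1 := by rw [← sq_abs]; nlinarith [abs_nonneg (y - x)]
  nlinarith [sq_nonneg (y - 2 * x)]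

/-- Lipschitz estimate with quadratic decay for `exp ∘ g`. -/
theorem abs_exp_comp_sub_le {g g' : ℝ → ℝ} {K s x y : ℝ} (hg : ∀ x, HasDerivAt g (g' x) x)
    (hK : ∀ x, |g' x| * Real.exp (g x) * (1 + x ^ 2) ≤ K) (hs : s ≤ 1) (h : |y - x| ≤ s) :
    |Real.exp (g x) - Real.exp (g y)| ≤ s * (3 * K) / (1 + y ^ 2) := by
  have hK0 : 0 ≤ K := le_trans (by positivity) (hK 0)
  have hb : ∀ ξ ∈ Set.uIcc y x, ‖Real.exp (g ξ) * g' ξ‖ ≤ 3 * K / (1 + y ^ 2) := by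
    intro ξ hξ
    have hξy : |y - ξ| ≤ s := by
      rw [abs_sub_comm]
      exact (Set.abs_sub_left_of_mem_uIcc hξ).trans ((abs_sub_comm x y).trans_le h)
    have h1 := one_add_sq_le_three_mul hs hξy
    rw [Real.norm_eq_abs, abs_mul, Real.abs_exp, le_div_iff₀ (by positivity)]
    have h3 : 0 ≤ |g' ξ| * Real.exp (g ξ) := by positivity
    nlinarith [hK ξ]
  have := (convex_uIcc y x).norm_image_sub_le_of_norm_hasDerivWithin_le
    (f := fun ξ => Real.exp (g ξ)) (fun ξ _ => (hg ξ).exp.hasDerivWithinAt) hb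
    Set.left_mem_uIcc Set.right_mem_uIcc
  rw [Real.norm_eq_abs, Real.norm_eq_abs, abs_sub_comm x y] at this
  calc _ ≤ 3 * K / (1 + y ^ 2) * |y - x| := this
    _ ≤ 3 * K / (1 + y ^ 2) * s := by gcongr
    _ = s * (3 * K) / (1 + y ^ 2) := by ring

/-- Kolmogorov distance between the rescaled magnetization and a law with density proportional
to `exp ∘ g`, in terms of the increments of the logarithms of the weights. -/
theorem kolmogorovDist_map_magnetization_le {n : ℕ} (hn : 1 ≤ n) {β s B D M η : ℝ} {g g' : ℝ → ℝ}
    {ν : Measure ℝ} (hs : 0 < s) (hs1 : s ≤ 1) (hB : 0 ≤ B) (hD : 0 ≤ D) (hη : 0 ≤ η)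
    (hg : ∀ x, HasDerivAt g (g' x) x) (hg' : ∀ x, |g' x| ≤ D * (1 + x ^ 2 + x ^ 6))
    (heven : ∀ x, g (-x) = g x) (hint : Integrable fun x => Real.exp (g x))
    (hM : ∀ x, Real.exp (g x) * Real.exp (B / 4 * x ^ 2) * (1 + x ^ 2 + x ^ 6) * (1 + x ^ 2) ≤ M)
    (hν : ∀ z, ν.real (Set.Iic z) = (∫ x in Set.Iic z, Real.exp (g x)) / ∫ x, Real.exp (g x))
    (hup : ∀ j < n, n < 2 * j + 1 →
      Real.log (curieWeissWeight n β (j + 1)) - Real.log (curieWeissWeight n β j) -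
        (g (s * ((2 * j + 1 - n) + 1)) - g (s * ((2 * j + 1 - n) - 1))) ≤
          B * s * (s * (2 * j + 1 - n)))
    (habs : ∀ j < n, n < 2 * j + 1 → (2 * j + 1 - n : ℝ) ≤ (n + 1) / 2 →
      |Real.log (curieWeissWeight n β (j + 1)) - Real.log (curieWeissWeight n β j) -
        (g (s * ((2 * j + 1 - n) + 1)) - g (s * ((2 * j + 1 - n) - 1)))| ≤
          η * s * (s * (2 * j + 1 - n) + (s * (2 * j + 1 - n)) ^ 5)) :
    kolmogorovDist ((curieWeiss n β).map fun x => s * magnetization n x) ν ≤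
      2 * (Real.pi * (M * (12 + 3 * D)) + 2 * M) / (∫ x, Real.exp (g x)) *
        (η + 1 / (s * n) ^ 2 + s) := by
  set p : ℝ → ℝ := fun x => Real.exp (g x) with hp
  set w : ℕ → ℝ := curieWeissWeight n β with hw
  set X : ℕ → ℝ := fun j => s * (2 * j - n) with hX
  set j₀ : ℕ := (n + 1) / 2 with hj₀
  -- `E j` is the logarithmic error of the weight against `exp ∘ g`, normalized to vanish at the
  -- central index.
  set E : ℕ → ℝ := fun j => Real.log (w j) - Real.log (w j₀) - g (X j) + g (X j₀) with hE
  set r : ℝ := 1 / (s * n) ^ 2 with hr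
  have hn0 : (0 : ℝ) < n := by exact_mod_cast hn
  have hsn : 0 < s * n := by positivity
  have hr0 : 0 < r := by positivity
  have hM0 : 0 ≤ M := le_trans (by positivity) (hM 0)
  have hM' : ∀ x q, 0 ≤ q → q ≤ (1 + x ^ 2 + x ^ 6) →
      p x * Real.exp (B / 4 * x ^ 2) * q * (1 + x ^ 2) ≤ M := fun x q h0 hq => by
    refine le_trans ?_ (hM x)
    gcongr
  have hexp : ∀ x : ℝ, 1 ≤ Real.exp (B / 4 * x ^ 2) := fun x =>
    Real.one_le_exp (by positivity)
  have hM'' : ∀ x q, 0 ≤ q → q ≤ (1 + x ^ 2 + x ^ 6) → p x * q * (1 + x ^ 2) ≤ M :=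
    fun x q h0 hq => by
      refine le_trans ?_ (hM' x q h0 hq)
      have : p x * 1 ≤ p x * Real.exp (B / 4 * x ^ 2) :=
        mul_le_mul_of_nonneg_left (hexp x) (Real.exp_pos _).le
      rw [mul_one] at this
      gcongr
  have hpM : ∀ x, p x ≤ M := fun x => by
    refine le_trans ?_ (hM'' x 1 zero_le_one (by nlinarith [sq_nonneg x, sq_nonneg (x ^ 3)]))
    have : 0 ≤ p x := (Real.exp_pos _).le
    nlinarith [sq_nonneg x]
  have hder : ∀ x, |g' x| * Real.exp (g x) * (1 + x ^ 2) ≤ D * M := fun x => by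
    have h1 : 0 ≤ 1 + x ^ 2 + x ^ 6 := by positivity
    calc |g' x| * Real.exp (g x) * (1 + x ^ 2)
        ≤ (D * (1 + x ^ 2 + x ^ 6)) * Real.exp (g x) * (1 + x ^ 2) := by
          gcongr; exact hg' x
      _ = D * (p x * (1 + x ^ 2 + x ^ 6) * (1 + x ^ 2)) := by rw [hp]; ring
      _ ≤ D * M := by gcongr; exact hM'' x _ h1 le_rfl
  have hEinc : ∀ j, E (j + 1) - E j = Real.log (w (j + 1)) - Real.log (w j) -
      (g (s * ((2 * j + 1 - n) + 1)) - g (s * ((2 * j + 1 - n) - 1))) := fun j => by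
    have h1 : X (j + 1) = s * ((2 * j + 1 - n) + 1) := by simp only [hX]; push_cast; ring
    have h2 : X j = s * ((2 * j + 1 - n) - 1) := by simp only [hX]; ring
    simp only [hE, h1, h2]
    ring
  have hEright : ∀ j, j₀ ≤ j → j ≤ n → E j ≤ B / 4 * X j ^ 2 ∧
      (|X j| ≤ s * n / 2 → |E j| ≤ η / 4 * (X j ^ 2 + X j ^ 6)) := fun j hj hjn => by
    have h := telescoped_bounds (E := E) hs hB hη (by simp only [hE]; ring)
      (fun j hj hj' => by rw [hEinc]; exact hup j hj hj')
      (fun j hj hj' hj'' => by rw [hEinc]; exact habs j hj hj' hj'') j hj hjn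
    refine ⟨h.1, fun hle => h.2 ?_⟩
    have h1 : s * (2 * j - n) ≤ s * (n / 2) := by
      have := (le_abs_self _).trans hle
      simp only [hX] at this
      linarith
    exact le_of_mul_le_mul_left h1 hs
  have hEall : ∀ j, j ≤ n → E j ≤ B / 4 * X j ^ 2 ∧
      (|X j| ≤ s * n / 2 → |E j| ≤ η / 4 * (X j ^ 2 + X j ^ 6)) := fun j hjn => by
    rcases le_or_gt j₀ j with h | h
    · exact hEright j h hjn
    -- The left half follows by the spin-flip symmetry `j ↦ n - j`.
    · have hXs : X (n - j) = -X j := by simp only [hX]; rw [Nat.cast_sub hjn]; ring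
      have hEs : E (n - j) = E j := by
        simp only [hE, hXs, heven, hw, curieWeissWeight_symm β hjn]
      have := hEright (n - j) (by omega) (by omega)
      rw [hXs, hEs, abs_neg] at this
      simpa only [even_two.neg_pow, (by decide : Even 6).neg_pow] using this
  have hEexp : ∀ j, j ≤ n →
      |Real.exp (E j) - 1| ≤ (η + 4 * r) * (X j ^ 2 + X j ^ 6) * Real.exp (B / 4 * X j ^ 2) :=
    fun j hjn => by
    obtain ⟨h1, h2⟩ := hEall j hjn
    have hq : 0 ≤ X j ^ 2 + X j ^ 6 := by positivity
    by_cases hx : |X j| ≤ s * n / 2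
    · refine (abs_exp_sub_one_le_abs_mul_exp h1 (by positivity)).trans ?_
      gcongr
      refine (h2 hx).trans ?_
      gcongr
      linarith
    -- Beyond half the range the trivial bound on `|exp E - 1|` is affordable, as `X j ^ 2` exceeds
    -- `1 / (4r)`.
    · have hX2 : 1 ≤ 4 * r * X j ^ 2 := by
        have h3 : (s * n / 2) ^ 2 ≤ X j ^ 2 := by
          rw [← sq_abs (X j)]
          exact pow_le_pow_left₀ (by positivity) (not_le.1 hx).le 2
        calc (1 : ℝ) = 4 * r * (s * n / 2) ^ 2 := by rw [hr]; field_simp; norm_num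
          _ ≤ 4 * r * X j ^ 2 := by gcongr
      have h4 : |Real.exp (E j) - 1| ≤ Real.exp (B / 4 * X j ^ 2) := by
        have h5 := Real.exp_le_exp.2 h1
        have h6 := Real.exp_pos (E j)
        have h7 := hexp (X j)
        rw [abs_le]; constructor <;> linarith
      refine h4.trans (le_mul_of_one_le_left (Real.exp_pos _).le (hX2.trans ?_))
      have : 0 ≤ X j ^ 6 := by positivity
      have h8 : 0 ≤ η * (X j ^ 2 + X j ^ 6) := by positivity
      nlinarith
  set τ : ℝ := η + r + s with hτ
  -- `12 = 3 · 4`: the `4` comes from `4 * r` above, the `3` from replacing `1 + X j ^ 2` by `1 + y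
  -- ^ 2`. The term `3 * D` is the variation of the density across a cell.
  set δ : ℝ := M * (12 + 3 * D) * τ with hδ
  have hτ0 : 0 ≤ τ := by positivity
  have hδ0 : 0 ≤ δ := by positivity
  set κ : ℝ := Real.exp (g (X j₀)) / w j₀ with hκ
  have hw0 : 0 < w j₀ := curieWeissWeight_pos β (by omega)
  have hκ0 : 0 < κ := by positivity
  have hc : ∀ j, j ≤ n → κ * w j = p (X j) * Real.exp (E j) := fun j hjn => by
    have hwj : 0 < w j := curieWeissWeight_pos β hjn
    simp only [hp, hE, hκ]
    rw [← Real.exp_add, show g (X j) + (Real.log (w j) - Real.log (w j₀) - g (X j) + g (X j₀)) =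
      g (X j₀) + Real.log (w j) - Real.log (w j₀) by ring, Real.exp_sub, Real.exp_add,
      Real.exp_log hwj, Real.exp_log hw0]
    ring
  have hin : ∀ j ≤ n, ∀ y, |y - s * (2 * j - n)| ≤ s → |κ * w j - p y| ≤ δ / (1 + y ^ 2) := by
    intro j hjn y hy
    change |y - X j| ≤ s at hy
    have h1 : |p (X j) - p y| ≤ s * (3 * (D * M)) / (1 + y ^ 2) :=
      abs_exp_comp_sub_le hg hder hs1 hy
    have h2 : |κ * w j - p (X j)| ≤ (η + 4 * r) * (3 * M) / (1 + y ^ 2) := by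
      rw [hc j hjn, ← mul_sub_one, abs_mul, abs_of_pos (Real.exp_pos _), le_div_iff₀ (by positivity)]
      have h3 := one_add_sq_le_three_mul hs1 hy
      have h4 := hM' (X j) (X j ^ 2 + X j ^ 6) (by positivity) (by linarith)
      calc p (X j) * |Real.exp (E j) - 1| * (1 + y ^ 2)
          ≤ p (X j) * ((η + 4 * r) * (X j ^ 2 + X j ^ 6) * Real.exp (B / 4 * X j ^ 2)) *
            (3 * (1 + X j ^ 2)) := by
            have := hEexp j hjn
            have h0 : 0 ≤ p (X j) := (Real.exp_pos _).le
            gcongr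
        _ = 3 * (η + 4 * r) *
            (p (X j) * Real.exp (B / 4 * X j ^ 2) * (X j ^ 2 + X j ^ 6) * (1 + X j ^ 2)) := by ring
        _ ≤ 3 * (η + 4 * r) * M := by gcongr
        _ = (η + 4 * r) * (3 * M) := by ring
    calc |κ * w j - p y| ≤ |κ * w j - p (X j)| + |p (X j) - p y| := abs_sub_le _ _ _
      _ ≤ (η + 4 * r) * (3 * M) / (1 + y ^ 2) + s * (3 * (D * M)) / (1 + y ^ 2) := by gcongr
      _ = ((η + 4 * r) * (3 * M) + s * (3 * (D * M))) / (1 + y ^ 2) := by ring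
      _ ≤ δ / (1 + y ^ 2) := by
        gcongr
        have e : δ - ((η + 4 * r) * (3 * M) + s * (3 * (D * M))) =
            M * η * 9 + M * s * 12 + M * (3 * D) * (η + r) := by rw [hδ, hτ]; ring
        have : 0 ≤ M * η * 9 + M * s * 12 + M * (3 * D) * (η + r) := by positivity
        linarith
  have hout : ∀ y, s * n ≤ |y| → p y ≤ δ / (1 + y ^ 2) := by
    intro y hy
    have h1 := hM'' y (y ^ 2) (by positivity) (by nlinarith [sq_nonneg (y ^ 3)])
    have h2 : (s * n) ^ 2 ≤ y ^ 2 := by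
      rw [← sq_abs y]
      exact pow_le_pow_left₀ hsn.le hy 2
    rw [le_div_iff₀ (by positivity)]
    have h0 : 0 ≤ p y := (Real.exp_pos _).le
    calc p y * (1 + y ^ 2) = r * (p y * (s * n) ^ 2 * (1 + y ^ 2)) := by rw [hr]; field_simp
      _ ≤ r * (p y * y ^ 2 * (1 + y ^ 2)) := by gcongr
      _ ≤ r * M := by gcongr
      _ ≤ δ := by
        have e : δ - r * M = M * r * (11 + 3 * D) + M * (12 + 3 * D) * (η + s) := by
          rw [hδ, hτ]; ring
        have : 0 ≤ M * r * (11 + 3 * D) + M * (12 + 3 * D) * (η + s) := by positivity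
        linarith
  have hp0 : ∀ y, 0 ≤ p y := fun y => (Real.exp_pos _).le
  set R : ℝ := (Real.pi * (M * (12 + 3 * D)) + 2 * M) * τ with hR
  have hRle : Real.pi * δ + 2 * s * M ≤ R := by
    have e : R - (Real.pi * δ + 2 * s * M) = 2 * M * (η + r) := by rw [hR, hδ, hτ]; ring
    have : 0 ≤ 2 * M * (η + r) := by positivity
    linarith
  have hZ : 0 < ∫ x, p x := integral_exp_pos hint
  have hWpos := sum_curieWeissWeight_pos n β
  have hcmp : ∀ z, |2 * s * κ * ∑ j ∈ Finset.range (n + 1),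
      (Set.Iic z).indicator (fun _ => w j) (s * (2 * j - n)) - ∫ y in Set.Iic z, p y| ≤ R := by
    intro z
    refine le_trans (le_of_eq ?_) ((abs_sum_lattice_sub_setIntegral_le hs hδ0 hint hp0 hpM hin hout
      (measurableSet_Iic (a := z)) z fun x y hxy => ?_).trans hRle)
    · classical
      rw [Finset.mul_sum]
      congr 2
      refine Finset.sum_congr rfl fun j _ => ?_
      simp only [Set.indicator_apply]
      split_ifs <;> ring
    · by_cases hz : |y - z| ≤ s
      · exact Or.inr hz
      · left
        rw [abs_le] at hxy
        rw [not_le, lt_abs] at hz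
        simp only [Set.mem_Iic]
        constructor <;> intro h <;> rcases hz with hz | hz <;> linarith
  have hcmp' : |2 * s * κ * ∑ j ∈ Finset.range (n + 1), w j - ∫ y, p y| ≤ R := by
    refine le_trans (le_of_eq ?_) ((abs_sum_lattice_sub_setIntegral_le hs hδ0 hint hp0 hpM hin hout
      MeasurableSet.univ 0 fun x y hxy => Or.inl (by simp)).trans hRle)
    rw [Finset.mul_sum, setIntegral_univ]
    congr 2
    refine Finset.sum_congr rfl fun j _ => ?_
    simp only [Set.indicator_univ]
    ring
  unfold kolmogorovDist
  refine ciSup_le fun z => ?_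
  rw [curieWeiss_map_real n β s measurableSet_Iic, hν z]
  have hsc : 0 < 2 * s * κ := by positivity
  have key := abs_div_sub_div_le hZ (mul_pos hsc hWpos) (mul_nonneg hsc.le
    (Finset.sum_nonneg fun j _ => Set.indicator_nonneg (s := Set.Iic z)
      (f := fun _ => w j) (fun _ _ => curieWeissWeight_nonneg n β j) (s * (2 * j - n))))
    (mul_le_mul_of_nonneg_left (Finset.sum_le_sum fun j _ =>
      Set.indicator_le_self' (s := Set.Iic z) (f := fun _ => w j)
      (fun _ _ => curieWeissWeight_nonneg n β j) (s * (2 * j - n))) hsc.le) (hcmp z) hcmp'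
  rw [mul_div_mul_left _ _ hsc.ne'] at key
  refine key.trans (le_of_eq ?_)
  rw [hR]
  ring

/-! ### Logarithm, moment and density estimates -/

theorem two_mul_le_log_one_add_div_one_sub {t : ℝ} (h0 : 0 ≤ t) (h1 : t < 1) :
    2 * t ≤ Real.log ((1 + t) / (1 - t)) := by
  have := Real.sum_range_le_log_div h0 h1 1
  norm_num at this
  linarith

theorem cubic_le_log_one_add_div_one_sub {t : ℝ} (h0 : 0 ≤ t) (h1 : t < 1) :
    2 * t + 2 / 3 * t ^ 3 ≤ Real.log ((1 + t) / (1 - t)) := by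
  have := Real.sum_range_le_log_div h0 h1 2
  norm_num [Finset.sum_range_succ] at this
  linarith

/-- The series tail is controlled by `1 / (1 - t²) ≤ 4/3`. Truncation from below needs only `t < 1`,
which is why upper bounds on the weights hold on the whole range and two-sided ones on half of it.
-/
theorem log_one_add_div_one_sub_le {t : ℝ} (h0 : 0 ≤ t) (h1 : t ≤ 1 / 2) :
    Real.log ((1 + t) / (1 - t)) ≤ 2 * t + 8 / 3 * t ^ 3 := by
  have := Real.log_div_le_sum_range_add h0 (by linarith : t < 1) 1
  norm_num at this
  have h : t ^ 3 / (1 - t ^ 2) ≤ 4 / 3 * t ^ 3 := by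
    have : 0 ≤ t ^ 3 := by positivity
    rw [div_le_iff₀ (by nlinarith)]
    have h2 : t ^ 2 ≤ 1 / 4 := by nlinarith
    nlinarith
  linarith

theorem log_one_add_div_one_sub_le_quintic {t : ℝ} (h0 : 0 ≤ t) (h1 : t ≤ 1 / 2) :
    Real.log ((1 + t) / (1 - t)) ≤ 2 * t + 2 / 3 * t ^ 3 + 8 / 3 * t ^ 5 := by
  have := Real.log_div_le_sum_range_add h0 (by linarith : t < 1) 2
  norm_num [Finset.sum_range_succ] at this
  have h : t ^ 5 / (1 - t ^ 2) ≤ 4 / 3 * t ^ 5 := by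
    have : 0 ≤ t ^ 5 := by positivity
    rw [div_le_iff₀ (by nlinarith)]
    have h2 : t ^ 2 ≤ 1 / 4 := by nlinarith
    nlinarith
  linarith

theorem polynomial_le_exp (c : ℝ) (hc : 0 < c) (x : ℝ) :
    (1 + x ^ 2 + x ^ 6) * (1 + x ^ 2) ≤ 24 / c ^ 4 * Real.exp (c * (1 + x ^ 2)) := by
  have h := Real.pow_div_factorial_le_exp (c * (1 + x ^ 2)) (by positivity) 4
  have h4 : (Nat.factorial 4 : ℝ) = 24 := by norm_num [Nat.factorial]
  rw [h4] at h
  calc (1 + x ^ 2 + x ^ 6) * (1 + x ^ 2) ≤ (1 + x ^ 2) ^ 4 := by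
        have e : (1 + x ^ 2) ^ 4 - (1 + x ^ 2 + x ^ 6) * (1 + x ^ 2) =
          x ^ 2 * (2 + 5 * x ^ 2 + 3 * x ^ 4) := by ring
        have : 0 ≤ x ^ 2 * (2 + 5 * x ^ 2 + 3 * x ^ 4) := by positivity
        linarith
    _ = 24 / c ^ 4 * ((c * (1 + x ^ 2)) ^ 4 / 24) := by field_simp
    _ ≤ _ := by gcongr

theorem measureReal_tilted_volume {g : ℝ → ℝ} {A : Set ℝ} (hA : MeasurableSet A) :
    ((volume : Measure ℝ).tilted g).real A =
      (∫ x in A, Real.exp (g x)) / ∫ x, Real.exp (g x) := by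
  rw [measureReal_def, tilted_apply_eq_ofReal_integral' _ hA, integral_div, ENNReal.toReal_ofReal]
  have h1 : 0 ≤ ∫ x in A, Real.exp (g x) := integral_nonneg fun _ => (Real.exp_pos _).le
  have h2 : 0 ≤ ∫ x, Real.exp (g x) := integral_nonneg fun _ => (Real.exp_pos _).le
  positivity

theorem measureReal_gaussianReal {A : Set ℝ} :
    (gaussianReal 0 1).real A =
      (∫ x in A, Real.exp (-x ^ 2 / 2)) / ∫ x : ℝ, Real.exp (-x ^ 2 / 2) := by
  have hZ : ∫ x : ℝ, Real.exp (-x ^ 2 / 2) = √(2 * Real.pi) := by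
    have := integral_gaussian (1 / 2)
    rw [show Real.pi / (1 / 2) = 2 * Real.pi by ring] at this
    rw [← this]
    congr 1
    ext x
    congr 1
    ring
  rw [measureReal_def, gaussianReal_apply_eq_integral 0 one_ne_zero, ENNReal.toReal_ofReal
    (integral_nonneg fun _ => gaussianPDFReal_nonneg _ _ _), hZ, gaussianPDFReal_def]
  simp only [sub_zero, NNReal.coe_one, mul_one]
  rw [integral_const_mul]
  ring

/-! ### Increment estimates in the two regimes -/

theorem quartic_increment_bounds {n q u γ β b : ℝ} (hq : 1 ≤ q) (hn : n = q ^ 4)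
    (hb : b = q ^ 2 * (β - 1) - γ) (hu : 0 < u) (hun : u ≤ n) {Δ : ℝ}
    (hΔ : Δ = -Real.log ((1 + u / (n + 1)) / (1 - u / (n + 1))) + 2 * β * u / n -
      ((-((q ^ 3)⁻¹ * (u + 1)) ^ 4 / 12 + γ * ((q ^ 3)⁻¹ * (u + 1)) ^ 2 / 2) -
        (-((q ^ 3)⁻¹ * (u - 1)) ^ 4 / 12 + γ * ((q ^ 3)⁻¹ * (u - 1)) ^ 2 / 2))) :
    Δ ≤ (2 * |b| + 5 / q ^ 2) * (q ^ 3)⁻¹ * ((q ^ 3)⁻¹ * u) ∧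
    (u ≤ (n + 1) / 2 → |Δ| ≤ (2 * |b| + 5 / q ^ 2) * (q ^ 3)⁻¹ *
      ((q ^ 3)⁻¹ * u + ((q ^ 3)⁻¹ * u) ^ 5)) := by
  have hq0 : 0 < q := by linarith
  have hn0 : 0 < n := by rw [hn]; positivity
  obtain ⟨x, hx⟩ : ∃ x, x = q⁻¹ := ⟨_, rfl⟩
  obtain ⟨v, hv⟩ : ∃ v, v = u / n := ⟨_, rfl⟩
  obtain ⟨ρ, hρ⟩ : ∃ ρ, ρ = n / (n + 1) := ⟨_, rfl⟩
  have hx0 : 0 < x := by rw [hx]; positivity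
  have hx1 : x ≤ 1 := by rw [hx]; exact inv_le_one_of_one_le₀ hq
  have hv0 : 0 < v := by rw [hv]; positivity
  have hv1 : v ≤ 1 := by rw [hv]; exact (div_le_one hn0).2 hun
  have hρ0 : 0 < ρ := by rw [hρ]; positivity
  have hρ1 : ρ < 1 := by rw [hρ, div_lt_one (by linarith)]; linarith
  have hρx : 1 - ρ ≤ x ^ 4 := by
    have e : 1 - ρ = 1 / (n + 1) := by rw [hρ]; field_simp; ring
    rw [e, hx, inv_pow, ← hn, ← one_div]
    gcongr
    linarith
  have ht : u / (n + 1) = v * ρ := by rw [hv, hρ]; field_simp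
  have hms : (q ^ 3)⁻¹ * ((q ^ 3)⁻¹ * u) = v * x ^ 2 := by
    rw [hv, hx, hn]; field_simp
  have hm5s : (q ^ 3)⁻¹ * ((q ^ 3)⁻¹ * u) ^ 5 * x ^ 2 = v ^ 5 := by
    rw [hv, hx, hn]; field_simp
  -- The terms `2v` and `(2/3)v³` cancel the start of the logarithm's series up to the discrepancy
  -- `ρ` between `n` and `n + 1`; `b` measures the distance from the critical window.
  have hΔ' : Δ = -Real.log ((1 + v * ρ) / (1 - v * ρ)) + 2 * v + 2 * b * (v * x ^ 2) +
      2 / 3 * (v ^ 3 + v * x ^ 8) := by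
    rw [hΔ, ht, hb, hv, hx, hn]
    field_simp
    ring
  have ht0 : 0 ≤ v * ρ := by positivity
  have ht1 : v * ρ < 1 := by nlinarith
  have hx2 : 0 < x ^ 2 := by positivity
  have hx84 : x ^ 8 ≤ x ^ 4 := pow_le_pow_of_le_one hx0.le hx1 (by norm_num)
  have hq2 : 5 / q ^ 2 = 5 * x ^ 2 := by rw [hx]; field_simp
  have hbl := le_abs_self b
  have hbl' := neg_abs_le b
  have hvx : 0 < v * x ^ 2 := by positivity
  have hlow := cubic_le_log_one_add_div_one_sub ht0 ht1
  have h1ρ : v * (1 - ρ) ≤ v * x ^ 4 := by gcongr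
  have hρ3 : 1 - ρ ^ 3 ≤ 3 * (1 - ρ) := by nlinarith [sq_nonneg (1 - ρ)]
  have hv3 : v ^ 3 ≤ v := by
    calc v ^ 3 ≤ v ^ 1 := pow_le_pow_of_le_one hv0.le hv1 (by norm_num)
      _ = v := pow_one v
  have hcub : v ^ 3 - (v * ρ) ^ 3 ≤ 3 * (v * x ^ 4) := by
    have h3 : 0 ≤ 1 - ρ ^ 3 := by
      have : ρ ^ 3 ≤ 1 := pow_le_one₀ hρ0.le hρ1.le
      linarith
    calc v ^ 3 - (v * ρ) ^ 3 = v ^ 3 * (1 - ρ ^ 3) := by ring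
      _ ≤ v * (1 - ρ ^ 3) := by gcongr
      _ ≤ v * (3 * (1 - ρ)) := by gcongr
      _ = 3 * (v * (1 - ρ)) := by ring
      _ ≤ 3 * (v * x ^ 4) := by gcongr
  have hb1 : b * (v * x ^ 2) ≤ |b| * (v * x ^ 2) := by gcongr
  have hb2 : -|b| * (v * x ^ 2) ≤ b * (v * x ^ 2) := by gcongr
  have hv8 : v * x ^ 8 ≤ v * x ^ 4 := by gcongr
  have hx4 : 0 < v * x ^ 4 := by positivity
  have hup : Δ ≤ (2 * |b| + 5 * x ^ 2) * (v * x ^ 2) := by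
    have e : (2 * |b| + 5 * x ^ 2) * (v * x ^ 2) = 2 * (|b| * (v * x ^ 2)) + 5 * (v * x ^ 4) := by
      ring
    rw [hΔ', e]
    linarith
  rw [hq2]
  refine ⟨?_, fun hu2 => ?_⟩
  · rwa [mul_assoc, hms]
  · have ht2 : v * ρ ≤ 1 / 2 := by
      rw [← ht, div_le_iff₀ (by linarith)]
      linarith
    have hhigh := log_one_add_div_one_sub_le_quintic ht0 ht2
    have h5 : (v * ρ) ^ 5 ≤ v ^ 5 := by
      gcongr
      exact mul_le_of_le_one_right hv0.le hρ1.le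
    have h3 : (v * ρ) ^ 3 ≤ v ^ 3 := by
      gcongr
      exact mul_le_of_le_one_right hv0.le hρ1.le
    have h1 : v * ρ ≤ v := mul_le_of_le_one_right hv0.le hρ1.le
    have hv8' : 0 ≤ v * x ^ 8 := by positivity
    have hv5 : 0 ≤ v ^ 5 := by positivity
    set Y : ℝ := (q ^ 3)⁻¹ * ((q ^ 3)⁻¹ * u) ^ 5 with hY
    have hY0 : 0 ≤ Y := by positivity
    have e : (2 * |b| + 5 * x ^ 2) * (q ^ 3)⁻¹ * ((q ^ 3)⁻¹ * u + ((q ^ 3)⁻¹ * u) ^ 5) =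
        (2 * |b| + 5 * x ^ 2) * (v * x ^ 2) + 2 * |b| * Y + 5 * v ^ 5 := by
      rw [← hms, ← hm5s]; ring
    have hbY : 0 ≤ 2 * |b| * Y := by positivity
    have hxx : 0 ≤ 5 * x ^ 2 * (v * x ^ 2) := by positivity
    rw [e, abs_le]
    constructor
    · rw [hΔ']
      linarith
    · linarith

theorem gaussian_increment_bounds {n ε s u β : ℝ} (hn : 0 < n) (hε : ε = 1 - β) (hε0 : 0 < ε)
    (hε1 : ε ≤ 1) (hεn : 4 ≤ ε * n) (hs : 0 < s) (hs2 : s ^ 2 = ε / n) (hu : 0 < u) (hun : u ≤ n)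
    {Δ : ℝ}
    (hΔ : Δ = -Real.log ((1 + u / (n + 1)) / (1 - u / (n + 1))) + 2 * β * u / n -
      (-(s * (u + 1)) ^ 2 / 2 - -(s * (u - 1)) ^ 2 / 2)) :
    Δ ≤ 1 / 2 * s * (s * u) ∧
    (u ≤ (n + 1) / 2 → |Δ| ≤ (3 / (ε ^ 2 * n)) * s * (s * u + (s * u) ^ 5)) := by
  obtain ⟨v, hv⟩ : ∃ v, v = u / n := ⟨_, rfl⟩
  obtain ⟨ρ, hρ⟩ : ∃ ρ, ρ = n / (n + 1) := ⟨_, rfl⟩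
  have hv0 : 0 < v := by rw [hv]; positivity
  have hv1 : v ≤ 1 := by rw [hv]; exact (div_le_one hn).2 hun
  have hρ0 : 0 < ρ := by rw [hρ]; positivity
  have hρ1 : ρ < 1 := by rw [hρ, div_lt_one (by linarith)]; linarith
  have hρn : 1 - ρ ≤ 1 / n := by
    have e : 1 - ρ = 1 / (n + 1) := by rw [hρ]; field_simp; ring
    rw [e]
    gcongr
    linarith
  have ht : u / (n + 1) = v * ρ := by rw [hv, hρ]; field_simp
  have hms : s * (s * u) = ε * v := by
    rw [hv, ← mul_assoc, ← sq, hs2]; field_simp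
  have hm3s : 1 / (ε ^ 2 * n) * (s * (s * u) ^ 3) = v ^ 3 := by
    have : s * (s * u) ^ 3 = (s ^ 2) ^ 2 * u ^ 3 := by ring
    rw [this, hs2, hv]; field_simp
  -- The `β`-dependence cancels exactly, because `s² = ε / n` matches the drift `2(β - 1)v`.
  have hΔ' : Δ = -Real.log ((1 + v * ρ) / (1 - v * ρ)) + 2 * v := by
    have e1 : -(s * (u + 1)) ^ 2 / 2 - -(s * (u - 1)) ^ 2 / 2 = -2 * (s * (s * u)) := by ring
    have e2 : 2 * β * u / n = 2 * (1 - ε) * v := by rw [hv, hε]; ring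
    rw [hΔ, ht, e1, hms, e2]
    ring
  have ht0 : 0 ≤ v * ρ := by positivity
  have ht1 : v * ρ < 1 := by nlinarith
  have hlow := two_mul_le_log_one_add_div_one_sub ht0 ht1
  have h1ρ : v * (1 - ρ) ≤ v * (1 / n) := by gcongr
  have hup : Δ ≤ 2 * (v * (1 / n)) := by rw [hΔ']; linarith
  refine ⟨?_, fun hu2 => ?_⟩
  · rw [mul_assoc, hms]
    refine hup.trans ?_
    have : 1 / n ≤ ε / 4 := by
      rw [div_le_div_iff₀ hn (by norm_num)]
      linarith
    nlinarith
  · have ht2 : v * ρ ≤ 1 / 2 := by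
      rw [← ht, div_le_iff₀ (by linarith)]
      linarith
    have hhigh := log_one_add_div_one_sub_le ht0 ht2
    have h3 : (v * ρ) ^ 3 ≤ v ^ 3 := by
      gcongr
      exact mul_le_of_le_one_right hv0.le hρ1.le
    have h1 : v * ρ ≤ v := mul_le_of_le_one_right hv0.le hρ1.le
    set m : ℝ := s * u with hm
    have hm0 : 0 < m := by positivity
    -- This fits the cubic error into the shape common to both regimes.
    have hm3 : m ^ 3 ≤ m + m ^ 5 := by nlinarith [sq_nonneg (m ^ 2 - 1), hm0]
    have hA : v ^ 3 ≤ 1 / (ε ^ 2 * n) * (s * (m + m ^ 5)) := by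
      rw [← hm3s]
      gcongr
    have hC : v * (1 / n) ≤ 1 / (ε ^ 2 * n) * (s * (m + m ^ 5)) := by
      calc v * (1 / n) ≤ 1 / (ε ^ 2 * n) * (ε * v) := by
            have : 1 / (ε ^ 2 * n) * (ε * v) = v * (1 / n) * (1 / ε) := by field_simp
            rw [this]
            refine le_mul_of_one_le_right (by positivity) ?_
            rw [one_div]
            exact (one_le_inv₀ hε0).2 hε1
        _ = 1 / (ε ^ 2 * n) * (s * m) := by rw [hms]
        _ ≤ _ := by
            gcongr
            have : 0 ≤ m ^ 5 := by positivity
            linarith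
    have e : 3 / (ε ^ 2 * n) * s * (m + m ^ 5) = 3 * (1 / (ε ^ 2 * n) * (s * (m + m ^ 5))) := by
      ring
    have hv3 : 0 ≤ v ^ 3 := by positivity
    have hvn : 0 ≤ v * (1 / n) := by positivity
    rw [e, abs_le]
    constructor
    · rw [hΔ']; linarith
    · linarith

/-! ### Uniform Kolmogorov bounds -/

theorem exists_kolmogorovDist_criticalSum_le (γ B₀ : ℝ) :
    ∃ C, 0 ≤ C ∧ ∀ n : ℕ, 1 ≤ n → ∀ β : ℝ, |√n * (β - 1) - γ| ≤ B₀ →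
      kolmogorovDist ((curieWeiss n β).map (criticalSum n)) (quarticLaw γ) ≤
        C * (|√n * (β - 1) - γ| + (n : ℝ) ^ (-1 / 2 : ℝ)) := by
  rcases lt_or_ge B₀ 0 with hB₀ | hB₀
  · exact ⟨0, le_rfl, fun n _ β hβ => absurd ((abs_nonneg _).trans hβ) (not_le.2 hB₀)⟩
  set g : ℝ → ℝ := fun x => -x ^ 4 / 12 + γ * x ^ 2 / 2 with hgdef
  set B : ℝ := 2 * B₀ + 5 with hB
  set c : ℝ := |γ| / 2 + B / 4 + 1 with hc
  -- `3c²` is the maximum of `-x⁴/12 + c x²`, attained at `x² = 6c`.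
  set M : ℝ := 24 * Real.exp (1 + 3 * c ^ 2) with hM
  set D : ℝ := 1 + |γ| with hD
  have hB0 : 0 ≤ B := by positivity
  have hM0 : 0 ≤ M := by positivity
  have hD0 : 0 ≤ D := by positivity
  have hZ : 0 < ∫ x, Real.exp (g x) := integral_exp_pos (integrable_exp_quartic γ)
  refine ⟨7 * (2 * (Real.pi * (M * (12 + 3 * D)) + 2 * M) / (∫ x, Real.exp (g x))),
    by positivity, fun n hn β hβ => ?_⟩
  obtain ⟨q, hqdef⟩ : ∃ q : ℝ, q = (n : ℝ) ^ (1 / 4 : ℝ) := ⟨_, rfl⟩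
  have hn1 : (1 : ℝ) ≤ n := by exact_mod_cast hn
  have hn0 : (0 : ℝ) ≤ n := by linarith
  have hq1 : 1 ≤ q := by rw [hqdef]; exact Real.one_le_rpow hn1 (by norm_num)
  have hq0 : 0 < q := by linarith
  have hq4 : (n : ℝ) = q ^ 4 := by
    rw [hqdef, ← Real.rpow_mul_natCast hn0]; norm_num
  have hq3 : (n : ℝ) ^ (3 / 4 : ℝ) = q ^ 3 := by
    rw [hqdef, ← Real.rpow_mul_natCast hn0]; norm_num
  have hq2 : √(n : ℝ) = q ^ 2 := by
    rw [hq4, show q ^ 4 = (q ^ 2) ^ 2 by ring, Real.sqrt_sq (by positivity)]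
  have hqm2 : (n : ℝ) ^ (-1 / 2 : ℝ) = 1 / q ^ 2 := by
    rw [neg_div, Real.rpow_neg hn0, ← Real.sqrt_eq_rpow, hq2, one_div]
  have hcrit : criticalSum n = fun x => (q ^ 3)⁻¹ * magnetization n x := by
    ext x
    rw [criticalSum, hq3, div_eq_inv_mul]
  rw [hqm2, hcrit, hq2]
  rw [hq2] at hβ
  obtain ⟨b, hb⟩ : ∃ b, b = q ^ 2 * (β - 1) - γ := ⟨_, rfl⟩
  rw [← hb] at hβ ⊢
  have hinc : ∀ j < n, n < 2 * j + 1 → _ ∧ _ := fun j hj hj' =>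
    quartic_increment_bounds (u := 2 * j + 1 - n) (β := β) (γ := γ) hq1 hq4 hb
      (by have : (n : ℝ) < 2 * j + 1 := by exact_mod_cast hj'
          linarith)
      (by have : (j : ℝ) + 1 ≤ n := by exact_mod_cast hj
          linarith) rfl
  have hs1 : (q ^ 3)⁻¹ ≤ 1 := inv_le_one_of_one_le₀ (one_le_pow₀ hq1)
  refine (kolmogorovDist_map_magnetization_le (B := B) (D := D) (M := M) (g := g)
    (g' := fun x => -x ^ 3 / 3 + γ * x) (η := 2 * |b| + 5 / q ^ 2) hn (s := (q ^ 3)⁻¹)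
    (by positivity) hs1 hB0 hD0 (by positivity) ?_ ?_ ?_ (integrable_exp_quartic γ) ?_
    (fun z => measureReal_tilted_volume measurableSet_Iic) ?_ ?_).trans ?_
  · intro x
    have h := (((hasDerivAt_pow 4 x).neg.div_const 12).add
      (((hasDerivAt_pow 2 x).const_mul γ).div_const 2))
    convert! h using 1
    push_cast
    ring
  · intro x
    have h1 : |x| ≤ 1 + x ^ 2 + x ^ 6 := by
      have := sq_abs x
      have : 0 ≤ x ^ 6 := by positivity
      nlinarith [sq_nonneg (|x| - 1)]
    have h3 : |x| ^ 3 ≤ 1 + x ^ 2 + x ^ 6 := by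
      have : (|x| ^ 3) ^ 2 = x ^ 6 := by rw [← pow_mul]; exact (by decide : Even 6).pow_abs x
      nlinarith [sq_nonneg (|x| ^ 3 - 1), sq_nonneg x]
    calc |-x ^ 3 / 3 + γ * x| ≤ |-x ^ 3 / 3| + |γ * x| := abs_add_le _ _
      _ = |x| ^ 3 / 3 + |γ| * |x| := by rw [abs_div, abs_neg, abs_pow, abs_mul]; norm_num
      _ ≤ (1 + x ^ 2 + x ^ 6) + |γ| * (1 + x ^ 2 + x ^ 6) := by
          gcongr
          have : 0 ≤ |x| ^ 3 := by positivity
          linarith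
      _ = D * (1 + x ^ 2 + x ^ 6) := by rw [hD]; ring
  · intro x
    simp only [hgdef]
    ring
  · intro x
    have h := polynomial_le_exp 1 one_pos x
    calc Real.exp (g x) * Real.exp (B / 4 * x ^ 2) * (1 + x ^ 2 + x ^ 6) * (1 + x ^ 2)
        = Real.exp (g x) * Real.exp (B / 4 * x ^ 2) * ((1 + x ^ 2 + x ^ 6) * (1 + x ^ 2)) := by ring
      _ ≤ Real.exp (g x) * Real.exp (B / 4 * x ^ 2) *
          (24 / 1 ^ 4 * Real.exp (1 * (1 + x ^ 2))) := by gcongr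
      _ = 24 * Real.exp (g x + B / 4 * x ^ 2 + 1 * (1 + x ^ 2)) := by
          rw [Real.exp_add (g x + B / 4 * x ^ 2), Real.exp_add (g x)]; ring
      _ ≤ M := by
          refine mul_le_mul_of_nonneg_left (Real.exp_le_exp.2 ?_) (by norm_num)
          have hcx : c * x ^ 2 = |γ| * x ^ 2 / 2 + B / 4 * x ^ 2 + x ^ 2 := by rw [hc]; ring
          have hγ : γ * x ^ 2 ≤ |γ| * x ^ 2 := by gcongr; exact le_abs_self γ
          simp only [hgdef]
          nlinarith [sq_nonneg (x ^ 2 - 6 * c)]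
  · intro j hj hj'
    rw [log_curieWeissWeight_succ_sub β hj]
    refine (hinc j hj hj').1.trans ?_
    have hu : (0 : ℝ) ≤ 2 * j + 1 - n := by
      have : (n : ℝ) < 2 * j + 1 := by exact_mod_cast hj'
      linarith
    have h5 : 5 / q ^ 2 ≤ 5 := div_le_self (by norm_num) (one_le_pow₀ hq1)
    have hBb : 2 * |b| + 5 / q ^ 2 ≤ B := by linarith
    gcongr
  · intro j hj hj' hj''
    rw [log_curieWeissWeight_succ_sub β hj]
    exact (hinc j hj hj').2 hj''
  · have hsn : 1 / ((q ^ 3)⁻¹ * (n : ℝ)) ^ 2 = 1 / q ^ 2 := by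
      rw [hq4]; field_simp
    have hs : (q ^ 3)⁻¹ ≤ 1 / q ^ 2 := by
      rw [one_div]
      exact inv_anti₀ (by positivity) (pow_le_pow_right₀ hq1 (by norm_num))
    have h5 : 5 / q ^ 2 = 5 * (1 / q ^ 2) := by ring
    have hK : 0 ≤ 2 * (Real.pi * (M * (12 + 3 * D)) + 2 * M) / (∫ x, Real.exp (g x)) := by
      positivity
    rw [hsn]
    refine (mul_le_mul_of_nonneg_left (?_ : _ ≤ 7 * (|b| + 1 / q ^ 2)) hK).trans
      (le_of_eq (by ring))
    linarith [abs_nonneg b]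

theorem exists_kolmogorovDist_gaussianSum_le :
    ∃ C, 0 ≤ C ∧ ∀ n : ℕ, 1 ≤ n → ∀ β : ℝ, 0 < 1 - β → 1 - β ≤ 1 → 4 ≤ (1 - β) * n →
      kolmogorovDist ((curieWeiss n β).map (gaussianSum n β)) (gaussianReal 0 1) ≤
        C * (1 / ((1 - β) ^ 2 * n) + (n : ℝ) ^ (-1 / 2 : ℝ)) := by
  set g : ℝ → ℝ := fun x => -x ^ 2 / 2 with hgdef
  set M : ℝ := 24 / (1 / 4) ^ 4 * Real.exp (1 / 4) with hM
  have hM0 : 0 ≤ M := by positivity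
  have hint : Integrable fun x => Real.exp (g x) := by
    refine (integrable_exp_neg_mul_sq (b := 1 / 2) (by norm_num)).congr (ae_of_all _ fun x => ?_)
    simp only [hgdef]
    congr 1
    ring
  have hZ : 0 < ∫ x, Real.exp (g x) := integral_exp_pos hint
  refine ⟨4 * (2 * (Real.pi * (M * (12 + 3 * 1)) + 2 * M) / (∫ x, Real.exp (g x))),
    by positivity, fun n hn β hβ0 hβ1 hβn => ?_⟩
  have hn1 : (1 : ℝ) ≤ n := by exact_mod_cast hn
  have hn0 : (0 : ℝ) < n := by linarith
  obtain ⟨s, hs⟩ : ∃ s, s = √((1 - β) / n) := ⟨_, rfl⟩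
  have hs0 : 0 < s := by rw [hs]; positivity
  have hs2 : s ^ 2 = (1 - β) / n := by rw [hs, Real.sq_sqrt (by positivity)]
  have hs1 : s ≤ (n : ℝ) ^ (-1 / 2 : ℝ) := by
    rw [neg_div, Real.rpow_neg hn0.le, ← Real.sqrt_eq_rpow, ← Real.sqrt_inv, hs]
    refine Real.sqrt_le_sqrt ?_
    rw [← one_div]
    gcongr
  have hsle : s ≤ 1 := hs1.trans (Real.rpow_le_one_of_one_le_of_nonpos hn1 (by norm_num))
  have hinc : ∀ j < n, n < 2 * j + 1 → _ ∧ _ := fun j hj hj' =>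
    gaussian_increment_bounds (u := 2 * j + 1 - n) (β := β) hn0 rfl hβ0 hβ1 hβn hs0 hs2
      (by have : (n : ℝ) < 2 * j + 1 := by exact_mod_cast hj'
          linarith)
      (by have : (j : ℝ) + 1 ≤ n := by exact_mod_cast hj
          linarith) rfl
  have hgs : gaussianSum n β = fun x => s * magnetization n x := by
    ext x
    rw [gaussianSum, hs]
  rw [hgs]
  refine (kolmogorovDist_map_magnetization_le (B := 1 / 2) (D := 1) (M := M) (g := g)
    (g' := fun x => -x) (η := 3 / ((1 - β) ^ 2 * n)) hn (s := s)
    hs0 hsle (by norm_num) zero_le_one (by positivity) ?_ ?_ ?_ hint ?_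
    (fun z => measureReal_gaussianReal) ?_ ?_).trans ?_
  · intro x
    have h := ((hasDerivAt_pow 2 x).neg.div_const 2)
    convert! h using 1
    push_cast
    ring
  · intro x
    rw [abs_neg, one_mul]
    have := sq_abs x
    have : 0 ≤ x ^ 6 := by positivity
    nlinarith [sq_nonneg (|x| - 1)]
  · intro x
    simp only [hgdef]
    ring
  · intro x
    have h := polynomial_le_exp (1 / 4) (by norm_num) x
    calc Real.exp (g x) * Real.exp (1 / 2 / 4 * x ^ 2) * (1 + x ^ 2 + x ^ 6) * (1 + x ^ 2)
        = Real.exp (g x) * Real.exp (1 / 2 / 4 * x ^ 2) *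
          ((1 + x ^ 2 + x ^ 6) * (1 + x ^ 2)) := by ring
      _ ≤ Real.exp (g x) * Real.exp (1 / 2 / 4 * x ^ 2) *
          (24 / (1 / 4) ^ 4 * Real.exp (1 / 4 * (1 + x ^ 2))) := by gcongr
      _ = 24 / (1 / 4) ^ 4 *
          Real.exp (g x + 1 / 2 / 4 * x ^ 2 + 1 / 4 * (1 + x ^ 2)) := by
          rw [Real.exp_add, Real.exp_add]; ring
      _ ≤ M := by
          rw [hM]
          gcongr
          simp only [hgdef]
          -- The coefficient of `x²` is `-1/2 + 1/8 + 1/4 < 0`.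
          nlinarith [sq_nonneg x]
  · intro j hj hj'
    rw [log_curieWeissWeight_succ_sub β hj]
    exact (hinc j hj hj').1
  · intro j hj hj' hj''
    rw [log_curieWeissWeight_succ_sub β hj]
    exact (hinc j hj hj').2 hj''
  · have hsn : 1 / (s * (n : ℝ)) ^ 2 ≤ 1 / ((1 - β) ^ 2 * n) := by
      have e : (s * (n : ℝ)) ^ 2 = (1 - β) * n := by
        rw [mul_pow, hs2]; field_simp
      rw [e]
      gcongr
      nlinarith
    have h3 : 3 / ((1 - β) ^ 2 * n) = 3 * (1 / ((1 - β) ^ 2 * n)) := by ring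
    have hK : 0 ≤ 2 * (Real.pi * (M * (12 + 3 * 1)) + 2 * M) / (∫ x, Real.exp (g x)) := by
      positivity
    have hn' : 0 ≤ (n : ℝ) ^ (-1 / 2 : ℝ) := by positivity
    refine (mul_le_mul_of_nonneg_left
      (?_ : _ ≤ 4 * (1 / ((1 - β) ^ 2 * n) + (n : ℝ) ^ (-1 / 2 : ℝ))) hK).trans
      (le_of_eq (by ring))
    linarith

/-! ### Kolmogorov distance and weak convergence -/

theorem abs_measureReal_sub_le_kolmogorovDist (μ ν : Measure ℝ) [IsProbabilityMeasure μ]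
    [IsProbabilityMeasure ν] (z : ℝ) :
    |μ.real (Set.Iic z) - ν.real (Set.Iic z)| ≤ kolmogorovDist μ ν := by
  refine le_ciSup (f := fun z : ℝ => |μ.real (Set.Iic z) - ν.real (Set.Iic z)|) ⟨1, ?_⟩ z
  rintro _ ⟨y, rfl⟩
  have h1 : μ.real (Set.Iic y) ≤ 1 := measureReal_le_one
  have h2 : ν.real (Set.Iic y) ≤ 1 := measureReal_le_one
  have h3 : 0 ≤ μ.real (Set.Iic y) := measureReal_nonneg
  have h4 : 0 ≤ ν.real (Set.Iic y) := measureReal_nonneg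
  exact abs_le.2 ⟨by linarith, by linarith⟩

theorem kolmogorovDist_nonneg (μ ν : Measure ℝ) : 0 ≤ kolmogorovDist μ ν :=
  Real.iSup_nonneg fun _ => abs_nonneg _

theorem kolmogorovDist_le_one (μ ν : Measure ℝ) [IsProbabilityMeasure μ]
    [IsProbabilityMeasure ν] : kolmogorovDist μ ν ≤ 1 := by
  refine ciSup_le fun y => ?_
  have h1 : μ.real (Set.Iic y) ≤ 1 := measureReal_le_one
  have h2 : ν.real (Set.Iic y) ≤ 1 := measureReal_le_one
  have h3 : 0 ≤ μ.real (Set.Iic y) := measureReal_nonneg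
  have h4 : 0 ≤ ν.real (Set.Iic y) := measureReal_nonneg
  exact abs_le.2 ⟨by linarith, by linarith⟩

/-- Convergence in Kolmogorov distance implies weak convergence. -/
theorem tendsto_of_tendsto_kolmogorovDist {μ : ℕ → ProbabilityMeasure ℝ} {ν : ProbabilityMeasure ℝ}
    (h : Tendsto (fun n => kolmogorovDist (μ n) ν) atTop (𝓝 0)) : Tendsto μ atTop (𝓝 ν) := by
  have hIic : ∀ z, Tendsto (fun n => (μ n : Measure ℝ).real (Set.Iic z)) atTop
      (𝓝 ((ν : Measure ℝ).real (Set.Iic z))) := fun z => by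
    rw [tendsto_iff_norm_sub_tendsto_zero]
    exact squeeze_zero (fun _ => norm_nonneg _)
      (fun n => abs_measureReal_sub_le_kolmogorovDist (μ n : Measure ℝ) ν z) h
  refine (isPiSystem_Ioc (id : ℝ → ℝ) id).tendsto_probabilityMeasure_of_tendsto_of_mem ?_ ?_ ?_
  · rintro _ ⟨a, b, _, rfl⟩
    exact measurableSet_Ioc
  · intro u hu x hx
    obtain ⟨e, he, hball⟩ := Metric.isOpen_iff.1 hu x hx
    refine ⟨Set.Ioc (x - e / 2) (x + e / 2), ⟨x - e / 2, x + e / 2, by simp only [id]; linarith, rfl⟩,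
      Ioc_mem_nhds (by linarith) (by linarith), fun y hy => hball ?_⟩
    rw [Metric.mem_ball, Real.dist_eq, abs_lt]
    constructor <;> linarith [hy.1, hy.2]
  · rintro _ ⟨a, b, hab, rfl⟩
    have hdiff : ∀ m : ProbabilityMeasure ℝ, (m : Measure ℝ).real (Set.Ioc a b) =
        (m : Measure ℝ).real (Set.Iic b) - (m : Measure ℝ).real (Set.Iic a) := fun m => by
      have hset : Set.Ioc a b = Set.Iic b \ Set.Iic a := by
        ext
        simp [and_comm]
      rw [hset, measureReal_sdiff (Set.Iic_subset_Iic.2 (show a ≤ b from hab.le)) measurableSet_Iic]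
    rw [← NNReal.tendsto_coe]
    change Tendsto (fun n => (μ n : Measure ℝ).real (Set.Ioc a b)) atTop
      (𝓝 ((ν : Measure ℝ).real (Set.Ioc a b)))
    simp_rw [hdiff]
    exact (hIic b).sub (hIic a)

theorem measurable_criticalSum (n : ℕ) : Measurable (criticalSum n) :=
  (measurable_magnetization n).div_const _

theorem measurable_gaussianSum (n : ℕ) (β : ℝ) : Measurable (gaussianSum n β) :=
  (measurable_magnetization n).const_mul _

/-! ### The regimes of the theorem -/

theorem tendsto_natCast_rpow_neg_half :
    Tendsto (fun n : ℕ => (n : ℝ) ^ (-1 / 2 : ℝ)) atTop (𝓝 0) := by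
  have := (tendsto_rpow_neg_atTop (y := 1 / 2) (by norm_num)).comp tendsto_natCast_atTop_atTop
  simpa [Function.comp_def, neg_div] using this

theorem tendstoInDistribution_criticalSum {β : ℕ → ℝ}
    (hβ : (fun n : ℕ => β n - 1) =o[atTop] (fun n : ℕ => (n : ℝ) ^ (-1 / 2 : ℝ))) :
    TendstoInDistribution criticalSum atTop (id : ℝ → ℝ)
        (fun n => curieWeiss n (β n)) (quarticLaw 0) := by
  have hb : Tendsto (fun n : ℕ => √n * (β n - 1)) atTop (𝓝 0) := by
    refine hβ.tendsto_div_nhds_zero.congr fun n => ?_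
    rw [neg_div, Real.rpow_neg n.cast_nonneg, ← Real.sqrt_eq_rpow, div_inv_eq_mul, mul_comm]
  obtain ⟨C, hC0, hC⟩ := exists_kolmogorovDist_criticalSum_le 0 1
  refine ⟨fun n => (measurable_criticalSum n).aemeasurable, aemeasurable_id,
    tendsto_of_tendsto_kolmogorovDist ?_⟩
  have hlim : Tendsto (fun n : ℕ => C * (|√n * (β n - 1) - 0| + (n : ℝ) ^ (-1 / 2 : ℝ))) atTop
      (𝓝 0) := by
    have := ((hb.sub_const 0).abs.add tendsto_natCast_rpow_neg_half).const_mul C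
    simpa using this
  refine tendsto_of_tendsto_of_tendsto_of_le_of_le' tendsto_const_nhds hlim
    (Eventually.of_forall fun _ => kolmogorovDist_nonneg _ _) ?_
  have hev : ∀ᶠ n : ℕ in atTop, |√n * (β n - 1) - 0| ≤ 1 := by
    have := (hb.sub_const 0).abs
    rw [sub_zero, abs_zero] at this
    exact (this.eventually_lt_const one_pos).mono fun _ h => h.le
  filter_upwards [hev, eventually_ge_atTop 1] with n h1 hn
  simp only [ProbabilityMeasure.coe_mk, Measure.map_id]
  exact hC n hn (β n) h1

/-- The Kolmogorov bound of the high-temperature regime holds eventually along a sequence `β` with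
`√n (1 - βₙ) → ∞` and `βₙ → 1`. -/
theorem eventually_kolmogorovDist_gaussianSum_le {C : ℝ}
    (hC : ∀ n : ℕ, 1 ≤ n → ∀ β : ℝ, 0 < 1 - β → 1 - β ≤ 1 → 4 ≤ (1 - β) * n →
      kolmogorovDist ((curieWeiss n β).map (gaussianSum n β)) (gaussianReal 0 1) ≤
        C * (1 / ((1 - β) ^ 2 * n) + (n : ℝ) ^ (-1 / 2 : ℝ)))
    {β : ℕ → ℝ} (hlim : Tendsto β atTop (𝓝 1)) (hlt : ∀ n : ℕ, 1 ≤ n → β n < 1)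
    (hβ : (fun n : ℕ => (n : ℝ) ^ (-1 / 2 : ℝ)) =o[atTop] (fun n : ℕ => β n - 1)) :
    ∀ᶠ n : ℕ in atTop,
      kolmogorovDist ((curieWeiss n (β n)).map (gaussianSum n (β n))) (gaussianReal 0 1) ≤
        C * (1 / ((1 - β n) ^ 2 * n) + (n : ℝ) ^ (-1 / 2 : ℝ)) := by
  filter_upwards [eventually_ge_atTop 1, hlim.eventually_const_lt zero_lt_one,
    hβ.bound (c := 1 / 2) (by norm_num)] with n hn h0 hb
  have hε : 0 < 1 - β n := by linarith [hlt n hn]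
  have hn1 : (1 : ℝ) ≤ n := by exact_mod_cast hn
  have hle : 1 - β n ≤ 1 := by linarith
  refine hC n hn (β n) hε hle ?_
  rw [neg_div, Real.rpow_neg n.cast_nonneg, ← Real.sqrt_eq_rpow, Real.norm_eq_abs, Real.norm_eq_abs,
    abs_sub_comm, abs_of_pos hε, abs_of_nonneg (by positivity)] at hb
  have hsq : 0 < √(n : ℝ) := by positivity
  have h2 : 2 ≤ (1 - β n) * √n := by
    have := mul_le_mul_of_nonneg_right hb hsq.le
    rw [inv_mul_cancel₀ hsq.ne'] at this
    linarith
  -- Since `1 - β n ≤ 1`, the bound `4 ≤ (1 - β n)² n` implies `4 ≤ (1 - β n) n`.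
  have h4 : 4 ≤ ((1 - β n) * √n) ^ 2 := by nlinarith
  rw [mul_pow, Real.sq_sqrt (by linarith)] at h4
  nlinarith

theorem theorem1p3 :
    -- (1) critical window
    (∀ γ : ℝ, γ ≠ 0 → ∃ C : ℝ, ∀ β : ℕ → ℝ, MonotoneToOne β →
      (∀ n : ℕ, 1 ≤ n → β n - 1 = γ / Real.sqrt n) →
      ∀ n : ℕ, 1 ≤ n →
        kolmogorovDist ((curieWeiss n (β n)).map (criticalSum n)) (quarticLaw γ)
          ≤ C * (n : ℝ) ^ (-1 / 2 : ℝ)) ∧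
    -- (2) close to the critical temperature: limit law
    (∀ β : ℕ → ℝ, MonotoneToOne β →
      (fun n : ℕ => β n - 1) =o[atTop] (fun n : ℕ => (n : ℝ) ^ (-1 / 2 : ℝ)) →
      TendstoInDistribution criticalSum atTop (id : ℝ → ℝ)
        (fun n => curieWeiss n (β n)) (quarticLaw 0)) ∧
    -- (2) rate if `|βₙ - 1| = O(1/n)`; the constant depends only on the one in the `O`
    (∀ K : ℝ, ∃ C : ℝ, ∀ β : ℕ → ℝ, MonotoneToOne β →
      (∀ n : ℕ, 1 ≤ n → |β n - 1| ≤ K / n) →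
      ∀ n : ℕ, 1 ≤ n →
        kolmogorovDist ((curieWeiss n (β n)).map (criticalSum n)) (quarticLaw 0)
          ≤ C * (n : ℝ) ^ (-1 / 2 : ℝ)) ∧
    -- (3) far from the critical temperature: central limit theorem
    (∀ β : ℕ → ℝ, MonotoneToOne β → (∀ n : ℕ, 1 ≤ n → β n < 1) →
      (fun n : ℕ => (n : ℝ) ^ (-1 / 2 : ℝ)) =o[atTop] (fun n : ℕ => β n - 1) →
      Tendsto (fun n : ℕ => kolmogorovDist
        ((curieWeiss n (β n)).map (gaussianSum n (β n))) (gaussianReal 0 1)) atTop (𝓝 0)) ∧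
    -- (3) rate if `|βₙ - 1| ≫ n^{-1/4}`, with an absolute constant for all large `n`,
    -- and hence with a constant depending on the sequence for all `n ≥ 1`
    (∃ C : ℝ, ∀ β : ℕ → ℝ, MonotoneToOne β → (∀ n : ℕ, 1 ≤ n → β n < 1) →
      (fun n : ℕ => (n : ℝ) ^ (-1 / 4 : ℝ)) =o[atTop] (fun n : ℕ => β n - 1) →
      (∀ᶠ n : ℕ in atTop, kolmogorovDist
        ((curieWeiss n (β n)).map (gaussianSum n (β n))) (gaussianReal 0 1)
          ≤ C * (n : ℝ) ^ (-1 / 2 : ℝ)) ∧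
      ∃ C' : ℝ, ∀ n : ℕ, 1 ≤ n → kolmogorovDist
        ((curieWeiss n (β n)).map (gaussianSum n (β n))) (gaussianReal 0 1)
          ≤ C' * (n : ℝ) ^ (-1 / 2 : ℝ)) := by
  have hhalf : ∀ n : ℕ, (n : ℝ) ^ (-1 / 2 : ℝ) = (√n)⁻¹ := fun n => by
    rw [neg_div, Real.rpow_neg n.cast_nonneg, ← Real.sqrt_eq_rpow]
  refine ⟨fun γ _ => ?_, fun β _ hβ => tendstoInDistribution_criticalSum hβ, fun K => ?_, ?_, ?_⟩
  · obtain ⟨C, _, hC⟩ := exists_kolmogorovDist_criticalSum_le γ 0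
    refine ⟨C, fun β _ hβ n hn => ?_⟩
    have hsq : 0 < √(n : ℝ) := by
      have : (1 : ℝ) ≤ n := by exact_mod_cast hn
      positivity
    have h0 : √n * (β n - 1) - γ = 0 := by rw [hβ n hn]; field_simp; ring
    have := hC n hn (β n) (by rw [h0, abs_zero])
    rwa [h0, abs_zero, zero_add] at this
  · obtain ⟨C, hC0, hC⟩ := exists_kolmogorovDist_criticalSum_le 0 K
    refine ⟨C * (K + 1), fun β _ hβ n hn => ?_⟩
    have hn1 : (1 : ℝ) ≤ n := by exact_mod_cast hn
    have hsq : 1 ≤ √(n : ℝ) := Real.one_le_sqrt.2 hn1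
    have hb : |√n * (β n - 1) - 0| ≤ K * (√(n : ℝ))⁻¹ := by
      rw [sub_zero, abs_mul, abs_of_nonneg (Real.sqrt_nonneg _)]
      calc √n * |β n - 1| ≤ √n * (K / n) := by gcongr; exact hβ n hn
        _ = K * (√(n : ℝ))⁻¹ := by
            rw [mul_div_left_comm, Real.sqrt_div_self', one_div]
    have hK : 0 ≤ K := by
      have := (abs_nonneg _).trans (hβ 1 le_rfl)
      simpa using this
    have hinv : (√(n : ℝ))⁻¹ ≤ 1 := inv_le_one_of_one_le₀ hsq
    have hbK : |√n * (β n - 1) - 0| ≤ K :=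
      hb.trans (mul_le_of_le_one_right hK hinv)
    refine (hC n hn (β n) hbK).trans ?_
    rw [hhalf, mul_assoc]
    refine mul_le_mul_of_nonneg_left ?_ hC0
    linarith
  · obtain ⟨C, hC0, hC⟩ := exists_kolmogorovDist_gaussianSum_le
    intro β hmon hlt hβ
    have hsmall : Tendsto (fun n : ℕ => ((n : ℝ) ^ (-1 / 2 : ℝ) / (β n - 1)) ^ 2) atTop (𝓝 0) := by
      have := hβ.tendsto_div_nhds_zero.pow 2
      simpa using this
    have hlim : Tendsto (fun n : ℕ => C * (((n : ℝ) ^ (-1 / 2 : ℝ) / (β n - 1)) ^ 2 +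
        (n : ℝ) ^ (-1 / 2 : ℝ))) atTop (𝓝 0) := by
      have := (hsmall.add tendsto_natCast_rpow_neg_half).const_mul C
      simpa using this
    refine tendsto_of_tendsto_of_tendsto_of_le_of_le' tendsto_const_nhds hlim
      (Eventually.of_forall fun _ => kolmogorovDist_nonneg _ _) ?_
    filter_upwards [eventually_kolmogorovDist_gaussianSum_le hC hmon.2 hlt hβ] with n h
    refine h.trans (le_of_eq ?_)
    rw [hhalf, div_pow, inv_pow, Real.sq_sqrt n.cast_nonneg, one_div, mul_inv,
      show (β n - 1) ^ 2 = (1 - β n) ^ 2 by ring]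
    ring
  · obtain ⟨C, hC0, hC⟩ := exists_kolmogorovDist_gaussianSum_le
    refine ⟨C * 2, fun β hmon hlt hβ => ?_⟩
    have hquarter : (fun n : ℕ => (n : ℝ) ^ (-1 / 2 : ℝ)) =O[atTop]
        (fun n : ℕ => (n : ℝ) ^ (-1 / 4 : ℝ)) := by
      refine IsBigO.of_bound 1 ?_
      filter_upwards [eventually_ge_atTop 1] with n hn
      have hn1 : (1 : ℝ) ≤ n := by exact_mod_cast hn
      rw [one_mul, Real.norm_of_nonneg (by positivity), Real.norm_of_nonneg (by positivity)]
      exact Real.rpow_le_rpow_of_exponent_le hn1 (by norm_num)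
    have hev : ∀ᶠ n : ℕ in atTop, kolmogorovDist
        ((curieWeiss n (β n)).map (gaussianSum n (β n))) (gaussianReal 0 1)
          ≤ C * 2 * (n : ℝ) ^ (-1 / 2 : ℝ) := by
      filter_upwards [eventually_kolmogorovDist_gaussianSum_le hC hmon.2 hlt
        (hquarter.trans_isLittleO hβ), hβ.bound (c := 1) one_pos, eventually_ge_atTop 1]
        with n h hb hn
      refine h.trans ?_
      rw [mul_assoc]
      refine mul_le_mul_of_nonneg_left ?_ hC0
      have hn1 : (1 : ℝ) ≤ n := by exact_mod_cast hn
      have hε : 0 < 1 - β n := by linarith [hlt n hn]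
      rw [one_mul, Real.norm_of_nonneg (by positivity), Real.norm_eq_abs, abs_sub_comm,
        abs_of_pos hε] at hb
      have hsq : (n : ℝ) ^ (-1 / 2 : ℝ) ≤ (1 - β n) ^ 2 := by
        calc (n : ℝ) ^ (-1 / 2 : ℝ) = ((n : ℝ) ^ (-1 / 4 : ℝ)) ^ 2 := by
              rw [← Real.rpow_mul_natCast n.cast_nonneg]; norm_num
          _ ≤ _ := by gcongr
      have hpos : 0 < (n : ℝ) ^ (-1 / 2 : ℝ) := by positivity
      have hmul : (n : ℝ) ^ (-1 / 2 : ℝ) * (n : ℝ) ^ (-1 / 2 : ℝ) * n = 1 := by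
        rw [hhalf, ← mul_inv, Real.mul_self_sqrt n.cast_nonneg, inv_mul_cancel₀ (by linarith)]
      have : 1 / ((1 - β n) ^ 2 * n) ≤ (n : ℝ) ^ (-1 / 2 : ℝ) := by
        rw [div_le_iff₀ (by positivity)]
        calc (1 : ℝ) = (n : ℝ) ^ (-1 / 2 : ℝ) * ((n : ℝ) ^ (-1 / 2 : ℝ) * n) := by
              rw [← mul_assoc, hmul]
          _ ≤ _ := by gcongr
      linarith
    refine ⟨hev, ?_⟩
    obtain ⟨N, hN⟩ := eventually_atTop.1 hev
    -- For the finitely many `n ≤ N` the distance is at most `1 = √n · n^{-1/2}`.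
    refine ⟨max (C * 2) √N, fun n hn => ?_⟩
    have hn1 : (1 : ℝ) ≤ n := by exact_mod_cast hn
    have hpos : 0 < (n : ℝ) ^ (-1 / 2 : ℝ) := by positivity
    rcases le_total N n with h | h
    · refine (hN n h).trans ?_
      gcongr
      exact le_max_left _ _
    · have hprob : IsProbabilityMeasure ((curieWeiss n (β n)).map (gaussianSum n (β n))) :=
        Measure.isProbabilityMeasure_map (measurable_gaussianSum n (β n)).aemeasurable
      calc _ ≤ (1 : ℝ) := kolmogorovDist_le_one _ _
        _ = √n * (n : ℝ) ^ (-1 / 2 : ℝ) := by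
            rw [hhalf, mul_inv_cancel₀ (by positivity)]
        _ ≤ max (C * 2) √N * (n : ℝ) ^ (-1 / 2 : ℝ) := by
            gcongr
            exact (Real.sqrt_le_sqrt (by exact_mod_cast h)).trans (le_max_right _ _)
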